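/- Let $d\ge 2$, let $\mathbb D=\{x\in\mathbb R^d: \|x\|<1\}$ be the open unit disk with its flat metric, and let $C_c^\infty(\mathbb D)$ be the space of real-valued test functions on $\mathbb D$. Put $\Delta=-\sum_i\partial_i^2$, and let $P(V)=\bigoplus_n \mathrm{Sym}^n V$ denote the symmetric algebra of a real vector space $V$. Let $$\mathrm F_{\mathrm{CL}}(\mathbb D)=P(C_c^\infty(\mathbb D))/\mathrm{Im}\,\Delta^{\mathrm{BV}},\qquad \Delta^{\mathrm{BV}}(f_1\cdots f_n\otimes h)=-f_1\cdots f_n\cdot\Delta h+\sum_{i}\Big(\int_{\mathbb D} f_ih\Big)f_1\cdots\widehat{f_i}\cdots f_n .$$ A *Green kernel* is a symmetric, locally integrable function $P(x,y)$ on $\mathbb D\times\mathbb D$ with $\Delta_xP(x,y)=\delta(x-y)$ as a distribution on $\mathbb D\times\mathbb D$. For such $P$ let $\partial_P$ be the operator on $P(C_c^\infty(\mathbb D))$ given by $$\partial_P(f_1\cdots f_n)=\sum_{i<j}\Big(\int_{\mathbb D\times\mathbb D}P(x,y)f_i(x)f_j(y)\,dx\,dy\Big)\prod_{k\ne i,j}f_k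 .$$ Then $\exp(\partial_P)$ induces a linear map $\Psi_P:\mathrm F_{\mathrm{CL}}(\mathbb D)\to P(C_c^\infty(\mathbb D)/\Delta C_c^\infty(\mathbb D))$. The state $\langle\,\cdot\,\rangle_P:\mathrm F_{\mathrm{CL}}(\mathbb D)\to\mathbb R$ is $\Psi_P$ followed by the projection onto the degree-zero part. Let $G_2(x,y)=-(2\pi)^{-1}\log\|x-y\|$ and, for $d\ge3$, $G_d(x,y)=\big((d-2)\,\omega_d\,\|x-y\|^{d-2}\big)^{-1}$, where $\omega_d$ is the volume of $S^{d-1}$. A *conformal self-embedding* of $\mathbb D$ is an injective smooth map $\phi:\mathbb D\to\mathbb D$ that is orientation preserving and satisfies $\phi^*g_{\mathrm{std}}=\Omega_\phi^2g_{\mathrm{std}}$ with $\Omega_\phi>0$ smooth. For $f\in C_c^\infty(\mathbb D)$ let $W_\phi(f)\in C_c^\infty(\mathbb D)$ be the function which equals $\Omega_\phi(\phi^{-1}(x))^{-\frac{d+2}{2}}f(\phi^{-1}(x))$ for $x\in\phi(\mathbb D)$ and $0$ elsewhere. 1. If $d\ge3$, then $G_d$ is a Green kernel and, for every conformal self-embedding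 $\phi$ of $\mathbb D$, all $n\ge0$ and all $f_1,\dots,f_n\in C_c^\infty(\mathbb D)$, $$\langle f_1\cdots f_n\rangle_{G_d}=\langle W_\phi(f_1)\cdots W_\phi(f_n)\rangle_{G_d}.$$ 2. If $d=2$, then $G_2$ is a Green kernel. For every conformal self-embedding $\phi$ of $\mathbb D$, with $\tilde H_\phi(x,y)=\log\|\phi(x)-\phi(y)\|-\log\|x-y\|$, the function $G_2-(2\pi)^{-1}\tilde H_\phi$ is a Green kernel and, for all $n\ge0$ and $f_1,\dots,f_n\in C_c^\infty(\mathbb D)$, $$\langle f_1\cdots f_n\rangle_{G_2-(2\pi)^{-1}\tilde H_\phi}=\langle W_\phi(f_1)\cdots W_\phi(f_n)\rangle_{G_2}.$$ The correction cannot be omitted: there are $\phi$, $n$ and $f_1,\dots,f_n\in C_c^\infty(\mathbb D)$ with $\langle f_1\cdots f_n\rangle_{G_2}\ne\langle W_\phi(f_1)\cdots W_\phi(f_n)\rangle_{G_2}$. 3. If $d=2$, $\phi$ is a conformal self-embedding of $\mathbb D$ that is the restriction of a Möbius transformation $z\mapsto\frac{az+b}{cz+e}$, $\begin{pmatrix}a&b\\c&e\end{pmatrix}\in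 \mathrm{SL}_2(\mathbb C)$ (under $\mathbb R^2\cong\mathbb C$), and $f_1,\dots,f_n\in C_c^\infty(\mathbb D)$ satisfy $\int_{\mathbb D}f_i=0$ for all $i$, then $$\langle f_1\cdots f_n\rangle_{G_2}=\langle W_\phi(f_1)\cdots W_\phi(f_n)\rangle_{G_2}.$$ -/

import Mathlib

open scoped TensorProduct Distributions ContDiff LineDeriv
open MeasureTheory

noncomputable section

namespace FreeField

section Algebra

/-- The symmetric algebra over `V`: `P(V) = ⨁ₙ Symⁿ V`. -/
abbrev Poly (V : Type*) [AddCommGroup V] [Module ℝ V] : Type _ := SymmetricAlgebra ℝ V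

variable {V : Type*} [AddCommGroup V] [Module ℝ V]

/-- The monomial `f₁ ⋯ fₙ` in `P(V)`. -/
def monomial {n : ℕ} (f : Fin n → V) : Poly V := ∏ i, SymmetricAlgebra.ι ℝ V (f i)

/-- A property closed under the module operations and under multiplication by generators holds on
all of `P(V)`. -/
theorem poly_induction {C : Poly V → Prop} (one : C 1)
    (smul : ∀ (r : ℝ) F, C F → C (r • F)) (add : ∀ F G, C F → C G → C (F + G))
    (mul : ∀ g F, C F → C (SymmetricAlgebra.ι ℝ V g * F)) (F : Poly V) : C F := by
  have key : ∀ F : Poly V, ∀ G, C G → C (F * G) := by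
    intro F
    induction F using SymmetricAlgebra.induction with
    | algebraMap r => intro G hG; rw [← Algebra.smul_def]; exact smul r G hG
    | ι x => exact fun G hG => mul x G hG
    | mul a b ha hb => intro G hG; rw [mul_assoc]; exact ha _ (hb _ hG)
    | add a b ha hb => intro G hG; rw [add_mul]; exact add _ _ (ha _ hG) (hb _ hG)
  simpa using key F 1 one

section Derivation

variable {N : Type*} [AddCommGroup N] [Module ℝ N] [Module (Poly V) N] [IsScalarTower ℝ (Poly V) N]

/-- The unique derivation `P(V) → N` extending a linear map `V → N`. It is the second component of
the algebra homomorphism from `P(V)` to the square-zero extension `P(V) ⊕ N` which maps `v` to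
`(v, g v)`. -/
def extendDeriv (g : V →ₗ[ℝ] N) : Poly V →ₗ[ℝ] N :=
  letI : Module (Poly V)ᵐᵒᵖ N :=
    Module.compHom _ ((RingHom.id (Poly V)).fromOpposite fun x y => mul_comm x y)
  haveI : IsCentralScalar (Poly V) N := ⟨fun _ _ => rfl⟩
  haveI : SMulCommClass (Poly V) (Poly V)ᵐᵒᵖ N := ⟨fun a b x => smul_comm a b.unop x⟩
  haveI : IsScalarTower ℝ (Poly V)ᵐᵒᵖ N := ⟨fun a b x => smul_assoc a b.unop x⟩
  (TrivSqZeroExt.sndHom (Poly V) N).restrictScalars ℝ ∘ₗ (SymmetricAlgebra.lift (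
    (TrivSqZeroExt.inlAlgHom ℝ (Poly V) N).toLinearMap ∘ₗ SymmetricAlgebra.ι ℝ V +
    (TrivSqZeroExt.inrHom (Poly V) N).restrictScalars ℝ ∘ₗ g)).toLinearMap

theorem extendDeriv_ι (g : V →ₗ[ℝ] N) (v : V) :
    extendDeriv g (SymmetricAlgebra.ι ℝ V v) = g v := by
  simp [extendDeriv]

theorem extendDeriv_mul (g : V →ₗ[ℝ] N) (F G : Poly V) :
    extendDeriv g (F * G) = F • extendDeriv g G + G • extendDeriv g F := by
  let : Module (Poly V)ᵐᵒᵖ N :=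
    Module.compHom _ ((RingHom.id (Poly V)).fromOpposite fun x y => mul_comm x y)
  have : IsCentralScalar (Poly V) N := ⟨fun _ _ => rfl⟩
  have : SMulCommClass (Poly V) (Poly V)ᵐᵒᵖ N := ⟨fun a b x => smul_comm a b.unop x⟩
  have : IsScalarTower ℝ (Poly V)ᵐᵒᵖ N := ⟨fun a b x => smul_assoc a b.unop x⟩
  have hfst : ∀ F : Poly V, (SymmetricAlgebra.lift (
    (TrivSqZeroExt.inlAlgHom ℝ (Poly V) N).toLinearMap ∘ₗ SymmetricAlgebra.ι ℝ V +
    (TrivSqZeroExt.inrHom (Poly V) N).restrictScalars ℝ ∘ₗ g) F).fst = F := by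
    intro F
    induction F using SymmetricAlgebra.induction with
    | algebraMap r => simp [AlgHom.commutes, TrivSqZeroExt.algebraMap_eq_inl']
    | ι x => simp
    | mul a b ha hb => rw [map_mul, TrivSqZeroExt.fst_mul, ha, hb]
    | add a b ha hb => rw [map_add, TrivSqZeroExt.fst_add, ha, hb]
  simp [extendDeriv, hfst]

theorem extendDeriv_one (g : V →ₗ[ℝ] N) : extendDeriv g 1 = 0 := by
  have h := extendDeriv_mul g 1 1
  rw [mul_one, one_smul] at h
  exact left_eq_add.mp h

theorem extendDeriv_ι_mul (g : V →ₗ[ℝ] N) (v : V) (F : Poly V) :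
    extendDeriv g (SymmetricAlgebra.ι ℝ V v * F) =
      SymmetricAlgebra.ι ℝ V v • extendDeriv g F + F • g v := by
  rw [extendDeriv_mul, extendDeriv_ι]

theorem extendDeriv_prod {I : Type*} [DecidableEq I] (g : V →ₗ[ℝ] N) (f : I → V) (s : Finset I) :
    extendDeriv g (∏ i ∈ s, SymmetricAlgebra.ι ℝ V (f i)) =
      ∑ i ∈ s, (∏ j ∈ s.erase i, SymmetricAlgebra.ι ℝ V (f j)) • g (f i) := by
  induction s using Finset.induction_on with
  | empty => simp [extendDeriv_one]
  | insert a s ha ih =>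
    rw [Finset.prod_insert ha, extendDeriv_ι_mul, ih, Finset.sum_insert ha,
      Finset.erase_insert ha, add_comm, Finset.smul_sum]
    congr 1
    refine Finset.sum_congr rfl fun i hi => ?_
    rw [Finset.erase_insert_of_ne (by rintro rfl; exact ha hi),
      Finset.prod_insert (fun h => ha (Finset.mem_of_mem_erase h)), mul_smul]

end Derivation

/-- The derivation of `P(V)` extending a linear form `ℓ`:
`f₁ ⋯ fₙ ↦ ∑ᵢ ℓ(fᵢ) f₁ ⋯ f̂ᵢ ⋯ fₙ`. -/
def contract (ℓ : V →ₗ[ℝ] ℝ) : Poly V →ₗ[ℝ] Poly V :=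
  extendDeriv (Algebra.linearMap ℝ (Poly V) ∘ₗ ℓ)

theorem contract_one (ℓ : V →ₗ[ℝ] ℝ) : contract ℓ 1 = 0 := extendDeriv_one _

theorem contract_ι_mul (ℓ : V →ₗ[ℝ] ℝ) (v : V) (F : Poly V) :
    contract ℓ (SymmetricAlgebra.ι ℝ V v * F) =
      SymmetricAlgebra.ι ℝ V v * contract ℓ F + ℓ v • F := by
  rw [contract, extendDeriv_ι_mul]
  simp [Algebra.smul_def, mul_comm]

theorem contract_add (ℓ ℓ' : V →ₗ[ℝ] ℝ) : contract (ℓ + ℓ') = contract ℓ + contract ℓ' := by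
  ext F
  induction F using poly_induction with
  | one => simp [contract_one]
  | smul r F h => simp only [map_smul, h]
  | add F G hF hG => simp only [map_add, hF, hG]
  | mul g F h =>
    simp only [contract_ι_mul, LinearMap.add_apply, h, mul_add, add_smul]; abel

theorem contract_smul (r : ℝ) (ℓ : V →ₗ[ℝ] ℝ) : contract (r • ℓ) = r • contract ℓ := by
  ext F
  induction F using poly_induction with
  | one => simp [contract_one]
  | smul r F h => simp only [map_smul, h]
  | add F G hF hG => simp only [map_add, hF, hG]
  | mul g F h =>
    simp only [contract_ι_mul, LinearMap.smul_apply, h, smul_add, smul_eq_mul, mul_smul,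
      mul_smul_comm]

theorem contract_comm (ℓ ℓ' : V →ₗ[ℝ] ℝ) (F : Poly V) :
    contract ℓ (contract ℓ' F) = contract ℓ' (contract ℓ F) := by
  induction F using poly_induction with
  | one => simp [contract_one]
  | smul r F h => simp only [map_smul, h]
  | add F G hF hG => simp only [map_add, hF, hG]
  | mul g F h =>
    simp only [contract_ι_mul, map_add, map_smul, h]; abel

/-- `contract ℓ`, as a function of `ℓ`. -/
def contractHom : (V →ₗ[ℝ] ℝ) →ₗ[ℝ] Poly V →ₗ[ℝ] Poly V where
  toFun := contract
  map_add' := contract_add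
  map_smul' := contract_smul

/-- The second-order operator attached to a bilinear form `B`:
`f₁ ⋯ fₙ ↦ ½ ∑_{i ≠ j} B(fᵢ, fⱼ) ∏_{k ≠ i, j} fₖ`, which is the sum over `i < j` if `B` is
symmetric. It is the composite of the universal derivation
`P(V) → P(V) ⊗ V, f₁ ⋯ fₙ ↦ ∑ᵢ (∏_{k ≠ i} fₖ) ⊗ fᵢ` with
`P(V) ⊗ V → P(V), F ⊗ f ↦ ½ contract (B f) F`. -/
def secondOrder (B : V →ₗ[ℝ] V →ₗ[ℝ] ℝ) : Poly V →ₗ[ℝ] Poly V :=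
  (2⁻¹ : ℝ) • (TensorProduct.lift (contractHom ∘ₗ B).flip ∘ₗ
    extendDeriv (TensorProduct.mk ℝ (Poly V) V 1))

/-- The value of `∂_B` on a monomial. -/
theorem secondOrder_prod {I : Type*} [DecidableEq I] (B : V →ₗ[ℝ] V →ₗ[ℝ] ℝ) (f : I → V)
    (s : Finset I) :
    secondOrder B (∏ i ∈ s, SymmetricAlgebra.ι ℝ V (f i)) =
      (2⁻¹ : ℝ) • ∑ i ∈ s, ∑ j ∈ s.erase i,
        B (f i) (f j) • ∏ k ∈ (s.erase i).erase j, SymmetricAlgebra.ι ℝ V (f k) := by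
  simp only [secondOrder, LinearMap.smul_apply, LinearMap.comp_apply, extendDeriv_prod, map_sum]
  refine congrArg _ (Finset.sum_congr rfl fun i _ => ?_)
  rw [TensorProduct.mk_apply, TensorProduct.smul_tmul', smul_eq_mul, mul_one,
    TensorProduct.lift.tmul]
  simp only [LinearMap.flip_apply, LinearMap.comp_apply, contractHom, LinearMap.coe_mk,
    AddHom.coe_mk, contract, extendDeriv_prod]
  refine Finset.sum_congr rfl fun j _ => ?_
  simp [Algebra.smul_def, mul_comm]

theorem secondOrder_one (B : V →ₗ[ℝ] V →ₗ[ℝ] ℝ) : secondOrder B 1 = 0 := by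
  simp [secondOrder, extendDeriv_one]

theorem secondOrder_ι_mul (B : V →ₗ[ℝ] V →ₗ[ℝ] ℝ) (g : V) (F : Poly V) :
    secondOrder B (SymmetricAlgebra.ι ℝ V g * F) =
      SymmetricAlgebra.ι ℝ V g * secondOrder B F +
        contract ((2⁻¹ : ℝ) • (B g + B.flip g)) F := by
  have h1 : ∀ T : Poly V ⊗[ℝ] V,
      TensorProduct.lift (contractHom ∘ₗ B).flip (SymmetricAlgebra.ι ℝ V g • T) =
        SymmetricAlgebra.ι ℝ V g * TensorProduct.lift (contractHom ∘ₗ B).flip T +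
          TensorProduct.lift ((LinearMap.lsmul ℝ (Poly V)).flip ∘ₗ LinearMap.id |>.compl₂ (B.flip g))
            T := by
    intro T
    induction T with
    | zero => simp
    | add T T' h h' => simp only [smul_add, map_add, h, h', mul_add]; abel
    | tmul G f =>
      simp [TensorProduct.smul_tmul', contractHom, contract_ι_mul]
  have h2 : ∀ F : Poly V, TensorProduct.lift
      ((LinearMap.lsmul ℝ (Poly V)).flip ∘ₗ LinearMap.id |>.compl₂ (B.flip g))
      (extendDeriv (TensorProduct.mk ℝ (Poly V) V 1) F) = contract (B.flip g) F := by
    intro F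
    induction F using poly_induction with
    | one => simp [extendDeriv_one, contract_one]
    | smul r F h => simp only [map_smul, h]
    | add F G hF hG => simp only [map_add, hF, hG]
    | mul v F h =>
      rw [contract_ι_mul, ← h, extendDeriv_ι_mul, map_add]
      congr 1
      · generalize extendDeriv (TensorProduct.mk ℝ (Poly V) V 1) F = T
        induction T with
        | zero => simp
        | add T T' h h' => simp only [smul_add, map_add, h, h', mul_add]
        | tmul G f => simp [TensorProduct.smul_tmul']
      · simp [TensorProduct.smul_tmul']
  simp only [secondOrder, LinearMap.smul_apply, LinearMap.comp_apply, extendDeriv_ι_mul, map_add, h1,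
    h2, contract_smul, contract_add, LinearMap.add_apply]
  simp [TensorProduct.smul_tmul', contractHom]
  abel

theorem secondOrder_contract (B : V →ₗ[ℝ] V →ₗ[ℝ] ℝ) (ℓ : V →ₗ[ℝ] ℝ) (F : Poly V) :
    secondOrder B (contract ℓ F) = contract ℓ (secondOrder B F) := by
  induction F using poly_induction with
  | one => simp [contract_one, secondOrder_one]
  | smul r F h => simp only [map_smul, h]
  | add F G hF hG => simp only [map_add, hF, hG]
  | mul g F h =>
    simp only [contract_ι_mul, secondOrder_ι_mul, map_add, map_smul, h]
    rw [contract_comm ℓ]; abel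

theorem secondOrder_pow_ι_mul (B : V →ₗ[ℝ] V →ₗ[ℝ] ℝ) (g : V) (F : Poly V) (k : ℕ) :
    (secondOrder B ^ (k + 1)) (SymmetricAlgebra.ι ℝ V g * F) =
      SymmetricAlgebra.ι ℝ V g * (secondOrder B ^ (k + 1)) F +
        ((k : ℝ) + 1) • contract ((2⁻¹ : ℝ) • (B g + B.flip g)) ((secondOrder B ^ k) F) := by
  have hs : ∀ (k : ℕ) (F : Poly V),
      (secondOrder B ^ (k + 1)) F = secondOrder B ((secondOrder B ^ k) F) :=
    fun k F => by rw [pow_succ', Module.End.mul_apply]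
  induction k with
  | zero => simp [secondOrder_ι_mul]
  | succ k ih =>
    rw [hs, ih, map_add, secondOrder_ι_mul, map_smul, secondOrder_contract, hs (k + 1), hs k]
    push_cast
    module

/-- `∂_B` lowers the degree by two, hence is locally nilpotent. -/
theorem secondOrder_locally_nilpotent (B : V →ₗ[ℝ] V →ₗ[ℝ] ℝ) (F : Poly V) :
    ∃ N, ∀ k, N ≤ k → (secondOrder B ^ k) F = 0 := by
  induction F using poly_induction with
  | one =>
    refine ⟨1, fun k hk => ?_⟩
    obtain ⟨k, rfl⟩ := Nat.exists_eq_add_of_le' hk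
    rw [pow_succ, Module.End.mul_apply, secondOrder_one, map_zero]
  | smul r F h =>
    obtain ⟨N, hN⟩ := h
    exact ⟨N, fun k hk => by rw [map_smul, hN k hk, smul_zero]⟩
  | add F G hF hG =>
    obtain ⟨N, hN⟩ := hF
    obtain ⟨M, hM⟩ := hG
    exact ⟨max N M, fun k hk => by
      rw [map_add, hN k (le_of_max_le_left hk), hM k (le_of_max_le_right hk), add_zero]⟩
  | mul g F h =>
    obtain ⟨N, hN⟩ := h
    refine ⟨N + 1, fun k hk => ?_⟩
    obtain ⟨k, rfl⟩ := Nat.exists_eq_add_of_le' (le_trans (Nat.le_add_left 1 N) hk)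
    rw [secondOrder_pow_ι_mul, hN (k + 1) (by omega), hN k (by omega)]
    simp

theorem finite_support_exp (B : V →ₗ[ℝ] V →ₗ[ℝ] ℝ) (F : Poly V) :
    (Function.support fun k : ℕ => ((k.factorial : ℝ)⁻¹) • (secondOrder B ^ k) F).Finite := by
  obtain ⟨N, hN⟩ := secondOrder_locally_nilpotent B F
  refine (Set.finite_lt_nat N).subset fun k hk => ?_
  by_contra hlt
  exact hk (by simp [hN k (not_lt.mp hlt)])

/-- `exp(∂_B) = ∑ₖ ∂_Bᵏ / k!`, a finite sum on every element of `P(V)`. -/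
def expSecondOrder (B : V →ₗ[ℝ] V →ₗ[ℝ] ℝ) : Poly V →ₗ[ℝ] Poly V where
  toFun F := ∑ᶠ k : ℕ, ((k.factorial : ℝ)⁻¹) • (secondOrder B ^ k) F
  map_add' F G := by
    rw [← finsum_add_distrib (finite_support_exp B F) (finite_support_exp B G)]
    simp only [map_add, smul_add]
  map_smul' r F := by
    rw [RingHom.id_apply, smul_finsum]
    simp only [map_smul, smul_comm r]

theorem expSecondOrder_eq_sum (B : V →ₗ[ℝ] V →ₗ[ℝ] ℝ) (F : Poly V) :
    ∃ N, ∀ M, N ≤ M → expSecondOrder B F =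
      ∑ k ∈ Finset.range M, ((k.factorial : ℝ)⁻¹) • (secondOrder B ^ k) F := by
  obtain ⟨N, hN⟩ := secondOrder_locally_nilpotent B F
  refine ⟨N, fun M hM => finsum_eq_sum_of_support_subset _ fun k hk => ?_⟩
  rw [Finset.coe_range, Set.mem_Iio]
  by_contra hlt
  exact hk (by simp [hN k (hM.trans (not_lt.mp hlt))])

theorem expSecondOrder_contract (B : V →ₗ[ℝ] V →ₗ[ℝ] ℝ) (ℓ : V →ₗ[ℝ] ℝ) (F : Poly V) :
    expSecondOrder B (contract ℓ F) = contract ℓ (expSecondOrder B F) := by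
  have hpow : ∀ k : ℕ, (secondOrder B ^ k) (contract ℓ F) = contract ℓ ((secondOrder B ^ k) F) := by
    intro k
    induction k with
    | zero => simp
    | succ k ih => rw [pow_succ', Module.End.mul_apply, ih, secondOrder_contract,
        Module.End.mul_apply]
  obtain ⟨N, hN⟩ := expSecondOrder_eq_sum B F
  obtain ⟨M, hM⟩ := expSecondOrder_eq_sum B (contract ℓ F)
  rw [hN _ (le_max_left N M), hM _ (le_max_right N M), map_sum]
  simp only [map_smul, hpow]

theorem expSecondOrder_ι_mul (B : V →ₗ[ℝ] V →ₗ[ℝ] ℝ) (g : V) (F : Poly V) :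
    expSecondOrder B (SymmetricAlgebra.ι ℝ V g * F) =
      SymmetricAlgebra.ι ℝ V g * expSecondOrder B F +
        contract ((2⁻¹ : ℝ) • (B g + B.flip g)) (expSecondOrder B F) := by
  obtain ⟨N, hN⟩ := expSecondOrder_eq_sum B F
  obtain ⟨M, hM⟩ := expSecondOrder_eq_sum B (SymmetricAlgebra.ι ℝ V g * F)
  have h1 := hN (max N M + 1) (by omega)
  have h2 := hN (max N M) (by omega)
  rw [hM (max N M + 1) (by omega), Finset.sum_range_succ']
  nth_rewrite 1 [h1]
  rw [h2, Finset.sum_range_succ', mul_add, Finset.mul_sum, map_sum]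
  have h3 : ∀ k : ℕ, (((k + 1).factorial : ℝ)⁻¹) •
      (secondOrder B ^ (k + 1)) (SymmetricAlgebra.ι ℝ V g * F) =
        SymmetricAlgebra.ι ℝ V g * ((((k + 1).factorial : ℝ)⁻¹) • (secondOrder B ^ (k + 1)) F) +
        contract ((2⁻¹ : ℝ) • (B g + B.flip g))
          (((k.factorial : ℝ)⁻¹) • (secondOrder B ^ k) F) := by
    intro k
    rw [secondOrder_pow_ι_mul, smul_add, mul_smul_comm, map_smul, smul_smul]
    congr 2
    have : (k.factorial : ℝ) ≠ 0 := by positivity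
    have : (k : ℝ) + 1 ≠ 0 := by positivity
    rw [Nat.factorial_succ]
    push_cast
    field_simp
  simp only [h3, Finset.sum_add_distrib]
  simp
  abel

end Algebra

section Disk

/-- Euclidean space `ℝᵈ`. -/
abbrev Space (d : ℕ) : Type := EuclideanSpace ℝ (Fin d)

/-- The open unit disk `𝔻 ⊆ ℝᵈ`. -/
def disk (d : ℕ) : TopologicalSpace.Opens (Space d) := ⟨Metric.ball 0 1, Metric.isOpen_ball⟩

/-- `𝔻 × 𝔻 ⊆ ℝᵈ × ℝᵈ`. -/
def diskSq (d : ℕ) : TopologicalSpace.Opens (Space d × Space d) :=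
  ⟨(disk d : Set (Space d)) ×ˢ (disk d : Set (Space d)), (disk d).isOpen.prod (disk d).isOpen⟩

/-- `C_c^∞(𝔻)`; its elements are identified with their extensions by zero to `ℝᵈ`. -/
abbrev Test (d : ℕ) : Type := 𝓓(disk d, ℝ)

/-- The conformal Laplacian `L = Δ = -∑ᵢ ∂ᵢ²` of the flat disk, on test functions. -/
def laplace (d : ℕ) : Test d →ₗ[ℝ] Test d :=
  -∑ i : Fin d, (LineDeriv.lineDerivOpCLM ℝ (Test d) (EuclideanSpace.single i (1 : ℝ))).toLinearMap ∘ₗ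
    (LineDeriv.lineDerivOpCLM ℝ (Test d) (EuclideanSpace.single i (1 : ℝ))).toLinearMap

/-- `Δ_x = -∑ᵢ ∂²/∂xᵢ²` on test functions `F(x, y)` on `𝔻 × 𝔻`. -/
def laplaceFst (d : ℕ) : 𝓓(diskSq d, ℝ) →ₗ[ℝ] 𝓓(diskSq d, ℝ) :=
  -∑ i : Fin d,
    (LineDeriv.lineDerivOpCLM ℝ 𝓓(diskSq d, ℝ) (EuclideanSpace.single i (1 : ℝ), (0 : Space d))).toLinearMap ∘ₗ
    (LineDeriv.lineDerivOpCLM ℝ 𝓓(diskSq d, ℝ) (EuclideanSpace.single i (1 : ℝ), (0 : Space d))).toLinearMap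

theorem integrable_mul_test {d : ℕ} (f h : Test d) : Integrable fun x => f x * h x :=
  (f.continuous.mul h.continuous).integrable_of_hasCompactSupport (f.hasCompactSupport.mul_right)

/-- The pairing `(h, f) ↦ ∫_𝔻 f h`. -/
def l2Pairing (d : ℕ) : Test d →ₗ[ℝ] Test d →ₗ[ℝ] ℝ :=
  LinearMap.mk₂ ℝ (fun h f => ∫ x in (disk d : Set (Space d)), f x * h x)
    (fun h h' f => by
      simp only [_root_.add_apply, mul_add]
      exact integral_add (integrable_mul_test f h).integrableOn
        (integrable_mul_test f h').integrableOn)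
    (fun r h f => by
      simp only [_root_.smul_apply, smul_eq_mul, mul_left_comm _ r]
      exact integral_const_mul _ _)
    (fun h f f' => by
      simp only [_root_.add_apply, add_mul]
      exact integral_add (integrable_mul_test f h).integrableOn
        (integrable_mul_test f' h).integrableOn)
    (fun r h f => by
      simp only [_root_.smul_apply, smul_eq_mul, mul_assoc]
      exact integral_const_mul _ _)

/-- The Batalin–Vilkovisky operator `P(C_c^∞(𝔻)) ⊗ C_c^∞(𝔻) → P(C_c^∞(𝔻))`,
`f₁ ⋯ fₙ ⊗ h ↦ -f₁ ⋯ fₙ · L h + ∑ᵢ (∫ fᵢ h) f₁ ⋯ f̂ᵢ ⋯ fₙ`. -/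
def bvOperator (d : ℕ) : Poly (Test d) ⊗[ℝ] Test d →ₗ[ℝ] Poly (Test d) :=
  TensorProduct.lift
    (-((LinearMap.mul ℝ (Poly (Test d))).compl₂ (SymmetricAlgebra.ι ℝ (Test d) ∘ₗ laplace d)) +
      (contractHom ∘ₗ l2Pairing d).flip)

theorem bvOperator_tmul {d : ℕ} (F : Poly (Test d)) (h : Test d) :
    bvOperator d (F ⊗ₜ h) =
      -(F * SymmetricAlgebra.ι ℝ (Test d) (laplace d h)) + contract (l2Pairing d h) F := by
  simp [bvOperator, contractHom]

/-- The space of quantum observables `F_CL(𝔻) = P(C_c^∞(𝔻)) / Im(Δ^BV)`. -/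
abbrev QuantumObs (d : ℕ) : Type := Poly (Test d) ⧸ LinearMap.range (bvOperator d)

/-- `S^cl(𝔻) = C_c^∞(𝔻) / Δ C_c^∞(𝔻)`. -/
abbrev ClassicalLin (d : ℕ) : Type := Test d ⧸ LinearMap.range (laplace d)

/-- `P` is a symmetric locally integrable function on `𝔻 × 𝔻` with `Δ_x P(x, y) = δ(x - y)` in the
sense of distributions on `𝔻 × 𝔻`. -/
structure IsGreenKernel (d : ℕ) (P : Space d → Space d → ℝ) : Prop where
  symm : ∀ x ∈ disk d, ∀ y ∈ disk d, P x y = P y x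
  locallyIntegrable : LocallyIntegrableOn (fun p : Space d × Space d => P p.1 p.2) (diskSq d)
  fundamental : ∀ F : 𝓓(diskSq d, ℝ),
    ∫ p in (diskSq d : Set (Space d × Space d)), P p.1 p.2 * laplaceFst d F p =
      ∫ x in (disk d : Set (Space d)), F (x, x)

/-- `(x, y) ↦ f(x) g(y)`. -/
def tensor {d : ℕ} (f g : Test d) : 𝓓(diskSq d, ℝ) :=
  have hsub : (Function.support fun q : Space d × Space d => f q.1 * g q.2) ⊆
      tsupport f ×ˢ tsupport g := fun _ hp =>
    ⟨subset_tsupport _ (left_ne_zero_of_mul hp), subset_tsupport _ (right_ne_zero_of_mul hp)⟩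
  have hK : IsCompact (tsupport f ×ˢ tsupport g) :=
    f.hasCompactSupport.isCompact.prod g.hasCompactSupport.isCompact
  { toFun := fun p => f p.1 * g p.2
    contDiff' := (f.contDiff.comp contDiff_fst).mul (g.contDiff.comp contDiff_snd)
    hasCompactSupport' := HasCompactSupport.of_support_subset_isCompact hK hsub
    tsupport_subset' := (closure_minimal hsub hK.isClosed).trans
      (Set.prod_mono f.tsupport_subset g.tsupport_subset) }

theorem tensor_apply {d : ℕ} (f g : Test d) (p : Space d × Space d) :
    tensor f g p = f p.1 * g p.2 := rfl

theorem lineDeriv_tensor {d : ℕ} (f g : Test d) (v : Space d) :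
    ∂_{((v, 0) : Space d × Space d)} (tensor f g) = tensor (∂_{v} f) g := by
  ext p
  rw [TestFunction.lineDerivOp_eq_lineDerivCLM ℝ, TestFunction.lineDerivCLM_apply_of_le (by simp),
    tensor_apply, TestFunction.lineDerivOp_eq_lineDerivCLM ℝ,
    TestFunction.lineDerivCLM_apply_of_le (by simp)]
  simp only [lineDeriv, tensor_apply, Prod.fst_add, Prod.snd_add, Prod.smul_fst, Prod.smul_snd,
    smul_zero, add_zero]
  exact deriv_mul_const_field _

theorem laplaceFst_tensor {d : ℕ} (f g : Test d) :
    laplaceFst d (tensor f g) = tensor (laplace d f) g := by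
  ext p
  simp [laplaceFst, laplace, lineDeriv_tensor, tensor_apply, Finset.sum_mul]


theorem integrable_kernel {d : ℕ} {P : Space d → Space d → ℝ} (hP : IsGreenKernel d P)
    (f g : Test d) : IntegrableOn (fun p : Space d × Space d => P p.1 p.2 * f p.1 * g p.2)
      (diskSq d) := by
  have hK := (tensor f g).hasCompactSupport.isCompact
  have h1 : IntegrableOn (fun p : Space d × Space d => P p.1 p.2 * tensor f g p)
      (tsupport (tensor f g)) :=
    (hP.locallyIntegrable.integrableOn_compact_subset (tensor f g).tsupport_subset hK).mul_continuousOn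
      (tensor f g).continuous.continuousOn hK
  have h2 : Integrable (fun p : Space d × Space d => P p.1 p.2 * tensor f g p) :=
    (integrableOn_iff_integrable_of_support_subset fun p hp =>
      subset_tsupport (tensor f g) (right_ne_zero_of_mul (Function.mem_support.mp hp))).mp h1
  refine (h2.congr (Filter.Eventually.of_forall fun p => ?_)).integrableOn
  simp only [tensor_apply, mul_assoc]

/-- The bilinear form `∂_P(f, g) = ∫_{𝔻 × 𝔻} P(x, y) f(x) g(y) dx dy`. -/
def kernelForm {d : ℕ} {P : Space d → Space d → ℝ} (hP : IsGreenKernel d P) :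
    Test d →ₗ[ℝ] Test d →ₗ[ℝ] ℝ :=
  LinearMap.mk₂ ℝ (fun f g => ∫ p in (diskSq d : Set (Space d × Space d)),
      P p.1 p.2 * f p.1 * g p.2)
    (fun f f' g => by
      simp only [_root_.add_apply, mul_add, add_mul]
      exact integral_add (integrable_kernel hP f g) (integrable_kernel hP f' g))
    (fun r f g => by
      simp only [_root_.smul_apply, smul_eq_mul, mul_left_comm _ r, mul_assoc]
      exact integral_const_mul _ _)
    (fun f g g' => by
      simp only [_root_.add_apply, mul_add]
      exact integral_add (integrable_kernel hP f g) (integrable_kernel hP f g'))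
    (fun r f g => by
      simp only [_root_.smul_apply, smul_eq_mul, mul_left_comm _ r]
      exact integral_const_mul _ _)

theorem kernelForm_symm {d : ℕ} {P : Space d → Space d → ℝ} (hP : IsGreenKernel d P)
    (f g : Test d) : kernelForm hP f g = kernelForm hP g f := by
  have hm : MeasurableSet (diskSq d : Set (Space d × Space d)) := (diskSq d).isOpen.measurableSet
  simp only [kernelForm, LinearMap.mk₂_apply]
  rw [← integral_indicator hm, ← integral_indicator hm, Measure.volume_eq_prod, ← integral_prod_swap]
  refine integral_congr_ae (Filter.Eventually.of_forall fun p => ?_)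
  by_cases hp : p ∈ (diskSq d : Set (Space d × Space d))
  · have hp' : p.swap ∈ (diskSq d : Set (Space d × Space d)) := ⟨hp.2, hp.1⟩
    simp only [Set.indicator_of_mem hp, Set.indicator_of_mem hp', Prod.fst_swap, Prod.snd_swap]
    rw [hP.symm _ hp.2 _ hp.1]
    ring
  · have hp' : p.swap ∉ (diskSq d : Set (Space d × Space d)) := fun h => hp ⟨h.2, h.1⟩
    simp only [Set.indicator_of_notMem hp, Set.indicator_of_notMem hp']

theorem kernelForm_laplace {d : ℕ} {P : Space d → Space d → ℝ} (hP : IsGreenKernel d P)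
    (f h : Test d) : kernelForm hP (laplace d h) f = l2Pairing d h f := by
  have := hP.fundamental (tensor h f)
  simp only [laplaceFst_tensor, tensor_apply] at this
  simp only [kernelForm, l2Pairing, LinearMap.mk₂_apply, mul_assoc, this, mul_comm (f _)]

/-- The projection `P(C_c^∞(𝔻)) → P(S^cl(𝔻))`. -/
def toClassical (d : ℕ) : Poly (Test d) →ₐ[ℝ] Poly (ClassicalLin d) :=
  SymmetricAlgebra.lift
    (SymmetricAlgebra.ι ℝ (ClassicalLin d) ∘ₗ (LinearMap.range (laplace d)).mkQ)

theorem toClassical_exp_bvOperator {d : ℕ} {P : Space d → Space d → ℝ} (hP : IsGreenKernel d P) :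
    LinearMap.range (bvOperator d) ≤
      LinearMap.ker ((toClassical d).toLinearMap ∘ₗ expSecondOrder (kernelForm hP)) := by
  rintro _ ⟨T, rfl⟩
  rw [LinearMap.mem_ker]
  induction T with
  | zero => simp
  | add T T' h h' => rw [map_add, map_add, h, h', add_zero]
  | tmul F h =>
    have hB : (2⁻¹ : ℝ) • (kernelForm hP (laplace d h) + (kernelForm hP).flip (laplace d h)) =
        l2Pairing d h := by
      ext f
      simp only [LinearMap.smul_apply, LinearMap.add_apply, LinearMap.flip_apply, smul_eq_mul,
        kernelForm_symm hP f, kernelForm_laplace]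
      ring
    have h0 : toClassical d (SymmetricAlgebra.ι ℝ (Test d) (laplace d h)) = 0 := by
      have : (LinearMap.range (laplace d)).mkQ (laplace d h) = 0 := by simp
      rw [toClassical, SymmetricAlgebra.lift_ι_apply, LinearMap.comp_apply, this, map_zero]
    rw [bvOperator_tmul, mul_comm, LinearMap.comp_apply, map_add, map_neg, expSecondOrder_ι_mul, hB,
      expSecondOrder_contract]
    simp [h0]

/-- The map `Ψ_P(𝔻) : F_CL(𝔻) → P(S^cl(𝔻))` induced by `exp(∂_P)`. -/
def quantization {d : ℕ} {P : Space d → Space d → ℝ} (hP : IsGreenKernel d P) :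
    QuantumObs d →ₗ[ℝ] Poly (ClassicalLin d) :=
  (LinearMap.range (bvOperator d)).liftQ
    ((toClassical d).toLinearMap ∘ₗ expSecondOrder (kernelForm hP)) (toClassical_exp_bvOperator hP)

/-- The state `⟨·⟩_P = pr₀ ∘ Ψ_P(𝔻) : F_CL(𝔻) → ℝ`, where `pr₀` is the projection of `P(S^cl(𝔻))`
onto its degree-zero part. -/
def state {d : ℕ} {P : Space d → Space d → ℝ} (hP : IsGreenKernel d P) : QuantumObs d →ₗ[ℝ] ℝ :=
  (SymmetricAlgebra.algebraMapInv (R := ℝ) (M := ClassicalLin d)).toLinearMap ∘ₗ quantization hP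

/-- The class of the monomial `f₁ ⋯ fₙ` in `F_CL(𝔻)`. -/
def observable {d n : ℕ} (f : Fin n → Test d) : QuantumObs d :=
  (LinearMap.range (bvOperator d)).mkQ (monomial f)

/-- The Green function: `-(2π)⁻¹ log |x - y|` if `d = 2`, and `1 / ((d - 2) ω_d |x - y|^(d - 2))`
if `d ≥ 3`, where `ω_d` is the volume of the unit sphere `S^(d-1)`. -/
def green (d : ℕ) (x y : Space d) : ℝ :=
  if d = 2 then -(2 * Real.pi)⁻¹ * Real.log ‖x - y‖
  else 1 / (((d : ℝ) - 2) * (volume : Measure (Space d)).toSphere.real Set.univ *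
    ‖x - y‖ ^ (d - 2))

/-- An orientation-preserving conformal open embedding `φ : 𝔻 → 𝔻`, with its conformal factor `Ω`,
`φ^* g_std = Ω² g_std`. Only the restrictions of the two functions to `𝔻` matter. An injective map
with these properties is a diffeomorphism onto an open subset by the inverse function theorem. -/
structure ConformalEmbedding (d : ℕ) where
  toFun : Space d → Space d
  factor : Space d → ℝ
  contDiffOn : ContDiffOn ℝ ∞ toFun (disk d)
  mapsTo : Set.MapsTo toFun (disk d) (disk d)
  injOn : Set.InjOn toFun (disk d)
  contDiffOn_factor : ContDiffOn ℝ ∞ factor (disk d)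
  factor_pos : ∀ x ∈ disk d, 0 < factor x
  conformal : ∀ x ∈ disk d, ∀ u v : Space d,
    inner ℝ (fderiv ℝ toFun x u) (fderiv ℝ toFun x v) = factor x ^ 2 * inner ℝ u v
  orientation : ∀ x ∈ disk d, 0 < (fderiv ℝ toFun x).det

namespace ConformalEmbedding

variable {d : ℕ} (φ : ConformalEmbedding d)

/-- `φ⁻¹ : φ(𝔻) → 𝔻`. -/
def inv : Space d → Space d := Function.invFunOn φ.toFun (disk d)

theorem inv_apply {x : Space d} (hx : x ∈ disk d) : φ.inv (φ.toFun x) = x :=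
  φ.injOn.leftInvOn_invFunOn hx

open Classical in
/-- The function `W_φ(f)`, which is `Ω(φ⁻¹(x))^(-(d+2)/2) f(φ⁻¹(x))` on `φ(𝔻)` and zero elsewhere. -/
def pushFun (f : Test d) (x : Space d) : ℝ :=
  if x ∈ φ.toFun '' (disk d) then
    φ.factor (φ.inv x) ^ (-(((d : ℝ) + 2) / 2)) * f (φ.inv x)
  else 0

theorem contDiffAt_inv {x : Space d} (hx : x ∈ disk d) :
    φ.toFun '' (disk d) ∈ nhds (φ.toFun x) ∧ ContDiffAt ℝ ∞ φ.inv (φ.toFun x) := by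
  have hmem : (disk d : Set (Space d)) ∈ nhds x := (disk d).isOpen.mem_nhds hx
  have hc : ContDiffAt ℝ ∞ φ.toFun x := φ.contDiffOn.contDiffAt hmem
  have hdet : (fderiv ℝ φ.toFun x).det ≠ 0 := (φ.orientation x hx).ne'
  set e : Space d ≃L[ℝ] Space d :=
    (fderiv ℝ φ.toFun x).toContinuousLinearEquivOfDetNeZero hdet with he
  have hd : HasFDerivAt φ.toFun (e : Space d →L[ℝ] Space d) x := by
    have := (hc.differentiableAt (by simp)).hasFDerivAt
    rwa [he, ContinuousLinearMap.coe_toContinuousLinearEquivOfDetNeZero]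
  have hs : HasStrictFDerivAt φ.toFun (e : Space d →L[ℝ] Space d) x :=
    hc.hasStrictFDerivAt' hd (by simp)
  refine ⟨?_, ?_⟩
  · have := hs.map_nhds_eq_of_equiv
    rw [← this]
    exact Filter.image_mem_map hmem
  · have hl := hc.to_localInverse hd (by simp)
    refine hl.congr_of_eventuallyEq ?_
    have h1 := hs.eventually_right_inverse
    have h2 : ∀ᶠ y in nhds (φ.toFun x), hs.localInverse φ.toFun e x y ∈ (disk d : Set (Space d)) := by
      have h3 := hs.localInverse_continuousAt
      exact h3.eventually (by rw [hs.localInverse_apply_image]; exact hmem)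
    filter_upwards [h1, h2] with y hy1 hy2
    conv_lhs => rw [← hy1]
    exact φ.inv_apply hy2

theorem support_pushFun (f : Test d) :
    Function.support (φ.pushFun f) ⊆ φ.toFun '' (tsupport f) := by
  intro x hx
  by_cases h : x ∈ φ.toFun '' (disk d)
  · obtain ⟨y, hy, rfl⟩ := h
    refine ⟨y, subset_tsupport _ fun h0 => hx ?_, rfl⟩
    simp [pushFun, φ.inv_apply hy, h0]
  · exact absurd (by simp [pushFun, h]) hx

theorem isCompact_image (f : Test d) : IsCompact (φ.toFun '' (tsupport f)) :=
  f.hasCompactSupport.isCompact.image_of_continuousOn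
    (φ.contDiffOn.continuousOn.mono f.tsupport_subset)

theorem contDiff_pushFun (f : Test d) : ContDiff ℝ ∞ (φ.pushFun f) := by
  rw [contDiff_iff_contDiffAt]
  intro x
  by_cases hx : x ∈ φ.toFun '' (tsupport f)
  · obtain ⟨y, hy, rfl⟩ := hx
    have hyD : y ∈ disk d := f.tsupport_subset hy
    obtain ⟨hn, hi⟩ := φ.contDiffAt_inv hyD
    have hinv : φ.inv (φ.toFun y) = y := φ.inv_apply hyD
    have h1 : ContDiffAt ℝ ∞ φ.factor (φ.inv (φ.toFun y)) := by
      rw [hinv]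
      exact φ.contDiffOn_factor.contDiffAt ((disk d).isOpen.mem_nhds hyD)
    have h2 : ContDiffAt ℝ ∞
        (fun x => φ.factor (φ.inv x) ^ (-(((d : ℝ) + 2) / 2)) * f (φ.inv x)) (φ.toFun y) := by
      refine ContDiffAt.mul ?_ ?_
      · refine ContDiffAt.rpow_const_of_ne (h1.comp _ hi) ?_
        simp only [hinv]
        exact (φ.factor_pos y hyD).ne'
      · exact f.contDiff.contDiffAt.comp _ hi
    refine h2.congr_of_eventuallyEq ?_
    filter_upwards [hn] with z hz
    rw [pushFun, if_pos hz]
  · have : φ.pushFun f =ᶠ[nhds x] fun _ => 0 := by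
      filter_upwards [(φ.isCompact_image f).isClosed.isOpen_compl.mem_nhds hx] with z hz
      by_contra h
      exact hz (φ.support_pushFun f h)
    exact contDiffAt_const.congr_of_eventuallyEq this

/-- `W_φ(f)`, which is again a test function on `𝔻`. -/
def push (f : Test d) : Test d where
  toFun := φ.pushFun f
  contDiff' := φ.contDiff_pushFun f
  hasCompactSupport' :=
    HasCompactSupport.of_support_subset_isCompact (φ.isCompact_image f) (φ.support_pushFun f)
  tsupport_subset' := (closure_minimal (φ.support_pushFun f) (φ.isCompact_image f).isClosed).trans
    (Set.image_subset_iff.mpr fun _ hx => φ.mapsTo (f.tsupport_subset hx))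

/-- `H̃_φ(x, y) = log |φ(x) - φ(y)| - log |x - y|`. -/
def harmonicCocycle (x y : Space d) : ℝ :=
  Real.log ‖φ.toFun x - φ.toFun y‖ - Real.log ‖x - y‖

end ConformalEmbedding

/-- The identification of `ℝ²` with `ℂ`. -/
def toComplex (x : Space 2) : ℂ := ⟨x 0, x 1⟩

/-- `φ` is the restriction to `𝔻` of an element of `Conf⁺(S²)`, that is, of a Möbius transformation
`z ↦ (az + b) / (cz + d)` with `ad - bc = 1`. -/
def ConformalEmbedding.IsMoebius (φ : ConformalEmbedding 2) : Prop :=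
  ∃ A : Matrix.SpecialLinearGroup (Fin 2) ℂ, ∀ x ∈ disk 2,
    A 1 0 * toComplex x + A 1 1 ≠ 0 ∧
      toComplex (φ.toFun x) = (A 0 0 * toComplex x + A 0 1) / (A 1 0 * toComplex x + A 1 1)

end Disk

end FreeField

end

/-! Everything reduces to two-point functions. Moving a generator past `exp(∂_P)` produces a
contraction, so the degree-zero part obeys Wick's recursion, and the state of `f₁ ⋯ fₙ` is
determined by the numbers `∂_P(fᵢ, fⱼ)` (`vev_prod_congr`, `state_congr`). By a change of variables
(`kernelForm_push`), pairing `W_φ f` with `W_φ g` through `P` is pairing `f` with `g` through `(Ω(x)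
Ω(y))^((d-2)/2) P(φ x, φ y)`. Each claim thus concerns the behaviour of this kernel for `P = G_d`.

For `d ≥ 3` it is `G_d` again, because `‖φ x - φ y‖² = Ω(x) Ω(y) ‖x - y‖²` (`norm_sub_sq_eq`), a
two-point form of Liouville's theorem. Put `λ = 1/Ω`. Differentiating the conformality relation
expresses `φ''` through `dφ` and `dλ`, and then `(λφ)''(u, v) = λ''(u, v) φ` for `u ⊥ v`. Symmetry
of third derivatives, applied with a direction orthogonal to both `u` and `v`, forces `λ''(u, v) =
0`. Consequently `z ↦ λ(z) ‖φ z - φ y‖²` has a Hessian proportional to the metric and a critical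
zero at `y`, so it is a multiple of `‖z - y‖²`; the constant is read off at `y`.

For `d = 2` the new kernel is `G₂(φ x, φ y) = G₂ - (2π)⁻¹ H̃_φ`. It is a Green kernel because the
planar Laplacian of a composite with `φ` acquires the factor `Ω²`, which is the Jacobian. Under
scaling by `1/2`, `H̃_φ` is a nonzero constant off the diagonal, whence the failure of invariance.
For a Möbius map `H̃_φ(x, y) = -(a(x) + a(y))` with `a = log |cz + e|`, and such a term is invisible
to functions of integral zero.

That `G_d` is a Green kernel is proved by replacing `‖z‖²` with `‖z‖² + ε`, integrating by parts
once, letting `ε → 0`, and evaluating the limit in polar coordinates. -/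

namespace FreeField

/-! ### Wick's theorem: states are determined by their two-point functions. -/

section Wick

variable {V : Type*} [AddCommGroup V] [Module ℝ V]

theorem algebraMapInv_ι_mul (g : V) (F : Poly V) :
    SymmetricAlgebra.algebraMapInv (R := ℝ) (M := V) (SymmetricAlgebra.ι ℝ V g * F) = 0 := by
  simp [SymmetricAlgebra.algebraMapInv]

theorem expSecondOrder_one (B : V →ₗ[ℝ] V →ₗ[ℝ] ℝ) : expSecondOrder B 1 = 1 := by
  obtain ⟨N, hN⟩ := expSecondOrder_eq_sum B 1
  rw [hN (N + 1) (by omega), Finset.sum_range_succ', Finset.sum_eq_zero]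
  · simp
  · intro k _
    rw [pow_succ, Module.End.mul_apply, secondOrder_one, map_zero, smul_zero]

/-- The degree-zero part of `exp(∂_B) F`. -/
noncomputable def vev (B : V →ₗ[ℝ] V →ₗ[ℝ] ℝ) : Poly V →ₗ[ℝ] ℝ :=
  (SymmetricAlgebra.algebraMapInv (R := ℝ) (M := V)).toLinearMap ∘ₗ expSecondOrder B

theorem vev_one (B : V →ₗ[ℝ] V →ₗ[ℝ] ℝ) : vev B 1 = 1 := by
  simp [vev, expSecondOrder_one]

/-- Wick's recursion. -/
theorem vev_ι_mul_prod {I : Type*} [DecidableEq I] (B : V →ₗ[ℝ] V →ₗ[ℝ] ℝ) (g : V) (f : I → V)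
    (s : Finset I) :
    vev B (SymmetricAlgebra.ι ℝ V g * ∏ i ∈ s, SymmetricAlgebra.ι ℝ V (f i)) =
      ∑ i ∈ s, (2⁻¹ * (B g (f i) + B (f i) g)) *
        vev B (∏ j ∈ s.erase i, SymmetricAlgebra.ι ℝ V (f j)) := by
  rw [vev, LinearMap.comp_apply, expSecondOrder_ι_mul, map_add, AlgHom.toLinearMap_apply,
    algebraMapInv_ι_mul, zero_add, ← expSecondOrder_contract, ← LinearMap.comp_apply, contract,
    extendDeriv_prod, map_sum]
  refine Finset.sum_congr rfl fun i _ => ?_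
  simp only [LinearMap.comp_apply, Algebra.linearMap_apply, smul_eq_mul]
  rw [mul_comm, ← Algebra.smul_def, map_smul, map_smul]
  rfl

/-- Wick's recursion removes two factors at a time, so strong induction on the index set applies.
Only values on the chosen families enter, which is why the families may lie in different spaces. -/
theorem vev_prod_congr {V' I : Type*} [AddCommGroup V'] [Module ℝ V'] [DecidableEq I]
    {B : V →ₗ[ℝ] V →ₗ[ℝ] ℝ} {B' : V' →ₗ[ℝ] V' →ₗ[ℝ] ℝ} {f : I → V} {f' : I → V'}
    (h : ∀ i j, B (f i) (f j) = B' (f' i) (f' j)) (s : Finset I) :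
    vev B (∏ i ∈ s, SymmetricAlgebra.ι ℝ V (f i)) =
      vev B' (∏ i ∈ s, SymmetricAlgebra.ι ℝ V' (f' i)) := by
  induction s using Finset.strongInduction with
  | H s ih =>
    rcases s.eq_empty_or_nonempty with rfl | ⟨a, ha⟩
    · simp [vev_one]
    · rw [← Finset.mul_prod_erase s _ ha, ← Finset.mul_prod_erase s _ ha, vev_ι_mul_prod,
        vev_ι_mul_prod]
      refine Finset.sum_congr rfl fun i hi => ?_
      rw [h, h, ih _ ((Finset.erase_subset _ _).trans_ssubset (Finset.erase_ssubset ha))]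

end Wick

variable {d : ℕ} {P : Space d → Space d → ℝ}

/-- Taking the degree-zero part kills every generator both before and after dividing by `Δ
C_c^∞(𝔻)`, so the quotient does not affect the state. -/
theorem state_observable (hP : IsGreenKernel d P) {n : ℕ} (f : Fin n → Test d) :
    state hP (observable f) =
      vev (kernelForm hP) (∏ i, SymmetricAlgebra.ι ℝ (Test d) (f i)) := by
  have h : (SymmetricAlgebra.algebraMapInv (R := ℝ) (M := ClassicalLin d)).comp (toClassical d) =
      SymmetricAlgebra.algebraMapInv := by
    ext f
    simp [toClassical, SymmetricAlgebra.algebraMapInv]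
  simp only [state, quantization, observable, vev, LinearMap.comp_apply, AlgHom.toLinearMap_apply,
    Submodule.mkQ_apply, Submodule.liftQ_apply, monomial, ← h, AlgHom.comp_apply]

theorem state_congr {d' : ℕ} {P' : Space d' → Space d' → ℝ} (hP : IsGreenKernel d P)
    (hP' : IsGreenKernel d' P') {n : ℕ} {f : Fin n → Test d} {f' : Fin n → Test d'}
    (h : ∀ i j, kernelForm hP (f i) (f j) = kernelForm hP' (f' i) (f' j)) :
    state hP (observable f) = state hP' (observable f') := by
  rw [state_observable, state_observable]
  exact vev_prod_congr h _

/-- The case `n = 2` exposes the bilinear form itself; the counterexample to invariance is detected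
here. -/
theorem state_pair (hP : IsGreenKernel d P) (f : Fin 2 → Test d) :
    state hP (observable f) = kernelForm hP (f 0) (f 1) := by
  have h := vev_ι_mul_prod (kernelForm hP) (f 0) f {1}
  rw [Finset.sum_singleton, Finset.erase_singleton, Finset.prod_empty, vev_one,
    kernelForm_symm hP (f 1)] at h
  rw [state_observable, Fin.prod_univ_two]
  rw [Finset.prod_singleton] at h
  rw [h]
  ring

/-! ### The Green function as a fundamental solution on `ℝᵈ`. -/

section Fundamental

open Metric Set Filter Topology

/-- The volume `ω_d` of the unit sphere `S^(d-1)`. -/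
noncomputable def sphereVolume (d : ℕ) : ℝ :=
  (volume : Measure (Space d)).toSphere.real Set.univ

theorem sphereVolume_pos {d : ℕ} (hd : 2 ≤ d) : 0 < sphereVolume d := by
  have : Nonempty (Fin d) := ⟨⟨0, by omega⟩⟩
  rw [sphereVolume, Measure.toSphere_real_apply_univ, finrank_euclideanSpace_fin]
  have h1 : 0 < (volume : Measure (Space d)).real (ball 0 1) :=
    ENNReal.toReal_pos (measure_ball_pos _ _ one_pos).ne' measure_ball_lt_top.ne
  positivity

theorem sphereVolume_two : sphereVolume 2 = 2 * Real.pi := by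
  rw [sphereVolume, Measure.toSphere_real_apply_univ, finrank_euclideanSpace_fin, measureReal_def,
    EuclideanSpace.volume_ball_fin_two]
  simp [Real.pi_pos.le]

/-- Fubini in polar coordinates for the radial derivative: `∫ |z|^(-d) (z · ∇k) = -ω_d k(0)`. -/
theorem integral_radial_deriv {d : ℕ} (hd : 2 ≤ d) {k : Space d → ℝ} (hk : ContDiff ℝ 1 k)
    (hc : HasCompactSupport k)
    (hi : Integrable fun z => (‖z‖ ^ d)⁻¹ * fderiv ℝ k z z) :
    ∫ z, (‖z‖ ^ d)⁻¹ * fderiv ℝ k z z = -(sphereVolume d * k 0) := by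
  have : Nontrivial (Space d) :=
    Module.nontrivial_of_finrank_pos (R := ℝ) (by rw [finrank_euclideanSpace_fin]; omega)
  set μ : Measure (Space d) := volume
  set F : Space d → ℝ := fun z => (‖z‖ ^ d)⁻¹ * fderiv ℝ k z z with hF
  set G : sphere (0 : Space d) 1 × Ioi (0 : ℝ) → ℝ := fun p => F (p.2.1 • p.1.1) with hG
  have hemb := (homeomorphUnitSphereProd (Space d)).measurableEmbedding
  have hGF : ∀ x : ({0}ᶜ : Set (Space d)), G (homeomorphUnitSphereProd (Space d) x) = F x := by
    intro x
    have hx : ‖(x : Space d)‖ ≠ 0 := norm_ne_zero_iff.mpr x.2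
    simp [hG, smul_smul, hx]
  have h1 : ∫ z, F z = ∫ p, G p ∂μ.toSphere.prod (.volumeIoiPow (Module.finrank ℝ (Space d) - 1)) := by
    rw [← μ.measurePreserving_homeomorphUnitSphereProd.integral_comp hemb]
    simp only [hGF]
    -- The origin, where polar coordinates break down, is a null set.
    rw [integral_subtype_comap (measurableSet_singleton _).compl, restrict_compl_singleton]
  have hGi : Integrable G (μ.toSphere.prod (.volumeIoiPow (Module.finrank ℝ (Space d) - 1))) := by
    rw [← μ.measurePreserving_homeomorphUnitSphereProd.integrable_comp_emb hemb]
    have : G ∘ homeomorphUnitSphereProd (Space d) = F ∘ Subtype.val := funext hGF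
    rw [this, ← integrableOn_iff_comap_subtypeVal (measurableSet_singleton _).compl]
    exact hi.integrableOn
  rw [h1, integral_prod _ hGi]
  have h2 : ∀ σ : sphere (0 : Space d) 1,
      ∫ r : Ioi (0 : ℝ), G (σ, r) ∂.volumeIoiPow (Module.finrank ℝ (Space d) - 1) = -k 0 := by
    intro σ
    have hσ : ‖(σ : Space d)‖ = 1 := by simp
    simp only [Measure.volumeIoiPow, ENNReal.ofReal]
    rw [integral_withDensity_eq_integral_smul (measurable_subtype_coe.pow_const _).real_toNNReal,
      integral_subtype_comap measurableSet_Ioi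
        fun a : ℝ => Real.toNNReal (a ^ (Module.finrank ℝ (Space d) - 1)) • F (a • σ.1)]
    -- The density `r^(d-1)` and the factor `r` from `dk(rσ)(rσ)` together cancel `‖rσ‖^(-d)`. What
    -- remains is the derivative of `r ↦ k(rσ)`, whose integral does not depend on `σ`.
    have h3 : ∀ r ∈ Ioi (0 : ℝ), Real.toNNReal (r ^ (Module.finrank ℝ (Space d) - 1)) • F (r • σ.1) =
        fderiv ℝ k (r • σ.1) σ.1 := by
      intro r hr
      have hr' : (0 : ℝ) < r := hr
      rw [NNReal.smul_def, Real.coe_toNNReal _ (pow_nonneg hr'.le _), finrank_euclideanSpace_fin, hF]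
      simp only [norm_smul, hσ, map_smul, smul_eq_mul, Real.norm_of_nonneg hr'.le, mul_one]
      obtain ⟨e, rfl⟩ : ∃ e, d = e + 1 := ⟨d - 1, by omega⟩
      rw [Nat.add_sub_cancel, pow_succ]
      field_simp
    rw [setIntegral_congr_fun measurableSet_Ioi h3]
    have hline : ∀ r : ℝ, HasDerivAt (fun r : ℝ => k (r • σ.1)) (fderiv ℝ k (r • σ.1) σ.1) r := by
      intro r
      have ha : HasDerivAt (fun r : ℝ => r • σ.1) σ.1 r := by
        simpa using (hasDerivAt_id r).smul_const σ.1
      exact ((hk.differentiable (by simp)).differentiableAt.hasFDerivAt).comp_hasDerivAt r ha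
    have hcl : IsClosedEmbedding fun r : ℝ => r • σ.1 :=
      isClosedEmbedding_smul_left (by rw [← norm_ne_zero_iff, hσ]; exact one_ne_zero)
    have hcs : HasCompactSupport fun r : ℝ => k (r • σ.1) := hc.comp_isClosedEmbedding hcl
    have hcs' : HasCompactSupport fun r : ℝ => fderiv ℝ k (r • σ.1) σ.1 := by
      have := (hc.fderiv ℝ).comp_isClosedEmbedding hcl
      exact this.comp_left (g := fun L : Space d →L[ℝ] ℝ => L σ.1) rfl
    have hcont : Continuous fun r : ℝ => fderiv ℝ k (r • σ.1) σ.1 :=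
      ((hk.continuous_fderiv (by simp)).comp (by fun_prop)).clm_apply continuous_const
    have ht : Tendsto (fun r : ℝ => k (r • σ.1)) atTop (𝓝 0) := by
      have h := hcs.is_zero_at_infty
      exact h.mono_left (by rw [cocompact_eq_atBot_atTop]; exact le_sup_right)
    have := integral_Ioi_of_hasDerivAt_of_tendsto (a := 0) (hline 0).continuousAt.continuousWithinAt
      (fun r _ => hline r) (hcont.integrable_of_hasCompactSupport hcs').integrableOn ht
    rw [this]
    simp
  simp only [h2]
  simp [sphereVolume, μ]

/-- In polar coordinates the density `y^(d-1)` absorbs the singularity of `p`; integrability on the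
ball becomes that of `q` on a bounded interval, where `q` is continuous up to the origin. -/
theorem integrableOn_ball_norm_comp {d : ℕ} (hd : 2 ≤ d) {p q : ℝ → ℝ} (hq : Continuous q)
    (h : ∀ y, 0 < y → y ^ (d - 1) * p y = q y) (R : ℝ) :
    IntegrableOn (fun z : Space d => p ‖z‖) (ball 0 R) := by
  have : Nontrivial (Space d) :=
    Module.nontrivial_of_finrank_pos (R := ℝ) (by rw [finrank_euclideanSpace_fin]; omega)
  rw [integrableOn_fun_norm_addHaar, finrank_euclideanSpace_fin]
  refine IntegrableOn.congr_fun (f := q) ?_ (fun y hy => (h y hy.1).symm) measurableSet_Ioo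
  exact (hq.integrableOn_Icc (a := 0) (b := R)).mono_set Ioo_subset_Icc_self

/-- The Green function as a function of the squared distance. -/
noncomputable def greenProfile (d : ℕ) (s : ℝ) : ℝ :=
  if d = 2 then -(4 * Real.pi)⁻¹ * Real.log s
  else (((d : ℝ) - 2) * sphereVolume d * s ^ (((d : ℝ) - 2) / 2))⁻¹

theorem green_eq_greenProfile {d : ℕ} (hd : 2 ≤ d) (x y : Space d) :
    green d x y = greenProfile d (‖x - y‖ ^ 2) := by
  unfold green greenProfile
  split_ifs with h
  · rw [Real.log_pow]
    push_cast
    field_simp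
    ring
  · have : (‖x - y‖ ^ 2) ^ (((d : ℝ) - 2) / 2) = ‖x - y‖ ^ (d - 2) := by
      rw [← Real.rpow_natCast, ← Real.rpow_mul (norm_nonneg _), ← Real.rpow_natCast,
        Nat.cast_sub hd]
      congr 1
      push_cast
      ring
    rw [this, one_div, sphereVolume]

/-- As functions of the squared distance, the logarithm and the power have the same formula for
their derivative, so the integration by parts needs no case distinction. -/
theorem hasDerivAt_greenProfile {d : ℕ} (hd : 2 ≤ d) {s : ℝ} (hs : 0 < s) :
    HasDerivAt (greenProfile d) (-(2 * sphereVolume d)⁻¹ * s ^ (-((d : ℝ) / 2))) s := by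
  have hω := sphereVolume_pos hd
  unfold greenProfile
  split_ifs with h
  · subst h
    have := (Real.hasDerivAt_log hs.ne').const_mul (-(4 * Real.pi)⁻¹)
    refine this.congr_deriv ?_
    have : -(((2 : ℕ) : ℝ) / 2) = -1 := by norm_num
    rw [sphereVolume_two, this, Real.rpow_neg_one]
    ring
  · have hd2 : (0 : ℝ) < (d : ℝ) - 2 := by
      have : (3 : ℝ) ≤ d := by exact_mod_cast (by omega : 3 ≤ d)
      linarith
    have h1 : HasDerivAt (fun s : ℝ => ((((d : ℝ) - 2) * sphereVolume d)⁻¹) *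
        s ^ (-(((d : ℝ) - 2) / 2))) ((((d : ℝ) - 2) * sphereVolume d)⁻¹ *
          (-(((d : ℝ) - 2) / 2) * s ^ (-(((d : ℝ) - 2) / 2) - 1))) s :=
      (Real.hasDerivAt_rpow_const (Or.inl hs.ne')).const_mul _
    have h2 : (fun s : ℝ => (((d : ℝ) - 2) * sphereVolume d * s ^ (((d : ℝ) - 2) / 2))⁻¹) =ᶠ[𝓝 s]
        fun s : ℝ => ((((d : ℝ) - 2) * sphereVolume d)⁻¹) * s ^ (-(((d : ℝ) - 2) / 2)) := by
      filter_upwards [lt_mem_nhds hs] with t ht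
      rw [Real.rpow_neg (le_of_lt ht), mul_inv]
    refine (h1.congr_of_eventuallyEq h2).congr_deriv ?_
    have : -(((d : ℝ) - 2) / 2) - 1 = -((d : ℝ) / 2) := by ring
    rw [this]
    field_simp

/-- Monotonicity traps the regularized kernel, for `0 < ε ≤ 1`, between its values at `ε = 1` and `ε
= 0`; this supplies the majorant for the limit. -/
theorem antitoneOn_greenProfile {d : ℕ} (hd : 2 ≤ d) : AntitoneOn (greenProfile d) (Ioi 0) := by
  have hω := sphereVolume_pos hd
  refine antitoneOn_of_deriv_nonpos (convex_Ioi 0)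
    (fun s hs => (hasDerivAt_greenProfile hd hs).continuousAt.continuousWithinAt) ?_ ?_
  · rw [interior_Ioi]
    exact fun s hs => (hasDerivAt_greenProfile hd hs).differentiableAt.differentiableWithinAt
  · rw [interior_Ioi]
    intro s hs
    rw [(hasDerivAt_greenProfile hd hs).deriv]
    have : (0 : ℝ) ≤ s ^ (-((d : ℝ) / 2)) := Real.rpow_nonneg (le_of_lt hs) _
    have h3 : (0 : ℝ) ≤ (2 * sphereVolume d)⁻¹ := by positivity
    nlinarith

theorem integrableOn_ball_greenProfile {d : ℕ} (hd : 2 ≤ d) (R : ℝ) :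
    IntegrableOn (fun z : Space d => greenProfile d (‖z‖ ^ 2)) (ball 0 R) := by
  have hω := sphereVolume_pos hd
  by_cases h : d = 2
  · subst h
    refine integrableOn_ball_norm_comp hd (p := fun r => greenProfile 2 (r ^ 2))
      (q := fun r => -(2 * Real.pi)⁻¹ * (r * Real.log r))
      (continuous_const.mul Real.continuous_mul_log) (fun y _ => ?_) R
    simp only [greenProfile, if_true, Real.log_pow]
    push_cast
    field_simp
    ring
  · refine integrableOn_ball_norm_comp hd (p := fun r => greenProfile d (r ^ 2))
      (q := fun r => (((d : ℝ) - 2) * sphereVolume d)⁻¹ * r) (by fun_prop) (fun y hy => ?_) R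
    have hd2 : (0 : ℝ) < (d : ℝ) - 2 := by
      have : (3 : ℝ) ≤ d := by exact_mod_cast (by omega : 3 ≤ d)
      linarith
    have : (y ^ 2) ^ (((d : ℝ) - 2) / 2) = y ^ (d - 2) := by
      rw [← Real.rpow_natCast, ← Real.rpow_mul hy.le, ← Real.rpow_natCast, Nat.cast_sub hd]
      congr 1
      push_cast
      ring
    simp only [greenProfile, if_neg h, this]
    obtain ⟨e, rfl⟩ : ∃ e, d = e + 2 := ⟨d - 2, by omega⟩
    rw [show e + 2 - 1 = e + 1 by omega, Nat.add_sub_cancel, pow_succ]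
    field_simp

/-- The sum of the second partial derivatives. -/
noncomputable def lap {d : ℕ} (k : Space d → ℝ) (z : Space d) : ℝ :=
  ∑ i, fderiv ℝ (fderiv ℝ k) z (EuclideanSpace.single i 1) (EuclideanSpace.single i 1)

theorem laplace_apply {d : ℕ} (f : Test d) (x : Space d) : laplace d f x = -lap f x := by
  have h1 : Differentiable ℝ f := f.contDiff.differentiable (by simp)
  have h2 : Differentiable ℝ (fderiv ℝ f) :=
    ((f.contDiff.of_le (m := 2) ENat.LEInfty.out).fderiv_right (m := 1)
      (by norm_num)).differentiable (by simp)
  have h : ∀ (g : Test d) (v x : Space d), (∂_{v} g) x = fderiv ℝ g x v := fun g v x => by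
    rw [TestFunction.lineDerivOp_eq_lineDerivCLM ℝ, TestFunction.lineDerivCLM_apply_of_le (by simp),
      ((g.contDiff.differentiable (by simp)) x).lineDeriv_eq_fderiv]
  have h' : ∀ v : Space d, ((∂_{v} (∂_{v} f : Test d) : Test d)) x =
      fderiv ℝ (fderiv ℝ f) x v v := fun v => by
    rw [h]
    have : ((∂_{v} f : Test d) : Space d → ℝ) = fun x => fderiv ℝ f x v := funext (h f v)
    rw [this, fderiv_clm_apply (h2 x) (differentiableAt_const _)]
    simp
  simp [laplace, lap, h']

theorem inner_eq_sum_single {d : ℕ} (L : Space d →L[ℝ] ℝ) (z : Space d) :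
    ∑ i, inner ℝ z (EuclideanSpace.single i (1 : ℝ)) * L (EuclideanSpace.single i 1) = L z := by
  conv_rhs => rw [← (EuclideanSpace.basisFun (Fin d) ℝ).sum_repr z]
  simp [map_sum, EuclideanSpace.inner_single_right]

/-- With `ε > 0` the kernel is differentiable everywhere, so integration by parts meets no
singularity. Its gradient is `-ω_d⁻¹ (‖z‖² + ε)^(-d/2) z`, and summing over coordinates assembles
`dk(z)(z)`. -/
theorem integral_regularized {d : ℕ} (hd : 2 ≤ d) {k : Space d → ℝ} (hk : ContDiff ℝ 2 k)
    (hc : HasCompactSupport k) {ε : ℝ} (hε : 0 < ε) :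
    ∫ z, greenProfile d (‖z‖ ^ 2 + ε) * lap k z =
      (sphereVolume d)⁻¹ * ∫ z, (‖z‖ ^ 2 + ε) ^ (-((d : ℝ) / 2)) * fderiv ℝ k z z := by
  have hpos : ∀ z : Space d, 0 < ‖z‖ ^ 2 + ε := fun z => by positivity
  have hf : ∀ z : Space d, HasFDerivAt (fun z : Space d => greenProfile d (‖z‖ ^ 2 + ε))
      ((-(2 * sphereVolume d)⁻¹ * (‖z‖ ^ 2 + ε) ^ (-((d : ℝ) / 2))) • (2 • innerSL ℝ z)) z :=
    fun z => HasDerivAt.comp_hasFDerivAt (h₂ := greenProfile d) z (hasDerivAt_greenProfile hd (hpos z))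
      ((hasStrictFDerivAt_norm_sq z).hasFDerivAt.add_const ε)
  have hfc : Continuous fun z : Space d => greenProfile d (‖z‖ ^ 2 + ε) :=
    continuous_iff_continuousAt.mpr fun z => (hf z).continuousAt
  have hwc : Continuous fun z : Space d => (‖z‖ ^ 2 + ε) ^ (-((d : ℝ) / 2)) :=
    Continuous.rpow_const (by fun_prop) fun z => Or.inl (hpos z).ne'
  have hk1 : ContDiff ℝ 1 (fderiv ℝ k) := hk.fderiv_right (by norm_num)
  have hk2 : Continuous (fderiv ℝ (fderiv ℝ k)) := hk1.continuous_fderiv (by simp)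
  have hkd : Continuous (fderiv ℝ k) := hk1.continuous
  have c1 : HasCompactSupport (fderiv ℝ k) := hc.fderiv ℝ
  have c2 : HasCompactSupport (fderiv ℝ (fderiv ℝ k)) := c1.fderiv ℝ
  have g1 : ∀ v : Space d, HasCompactSupport fun z => fderiv ℝ k z v := fun v =>
    c1.comp_left (g := fun L : Space d →L[ℝ] ℝ => L v) rfl
  have g2 : ∀ v : Space d, HasCompactSupport fun z => fderiv ℝ (fderiv ℝ k) z v v := fun v =>
    c2.comp_left (g := fun L : Space d →L[ℝ] Space d →L[ℝ] ℝ => L v v) rfl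
  have i2 : ∀ v : Space d, Integrable fun z : Space d =>
      greenProfile d (‖z‖ ^ 2 + ε) * fderiv ℝ (fderiv ℝ k) z v v := fun v =>
    (hfc.mul ((hk2.clm_apply continuous_const).clm_apply
      continuous_const)).integrable_of_hasCompactSupport (g2 v).mul_left
  have i1 : ∀ v : Space d, Integrable fun z : Space d =>
      (‖z‖ ^ 2 + ε) ^ (-((d : ℝ) / 2)) * (inner ℝ z v * fderiv ℝ k z v) := fun v =>
    (hwc.mul ((continuous_id.inner continuous_const).mul
      (hkd.clm_apply continuous_const))).integrable_of_hasCompactSupport (g1 v).mul_left.mul_left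
  have key : ∀ v : Space d, ∫ z, greenProfile d (‖z‖ ^ 2 + ε) * fderiv ℝ (fderiv ℝ k) z v v =
      (sphereVolume d)⁻¹ *
        ∫ z, (‖z‖ ^ 2 + ε) ^ (-((d : ℝ) / 2)) * (inner ℝ z v * fderiv ℝ k z v) := by
    intro v
    have hgd : ∀ z, fderiv ℝ (fun z => fderiv ℝ k z v) z v = fderiv ℝ (fderiv ℝ k) z v v := by
      intro z
      rw [fderiv_clm_apply (hk1.differentiable (by simp) z) (differentiableAt_const _)]
      simp
    have hfd : ∀ z, fderiv ℝ (fun z : Space d => greenProfile d (‖z‖ ^ 2 + ε)) z v *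
        fderiv ℝ k z v = -(sphereVolume d)⁻¹ *
          ((‖z‖ ^ 2 + ε) ^ (-((d : ℝ) / 2)) * (inner ℝ z v * fderiv ℝ k z v)) := by
      intro z
      rw [(hf z).fderiv]
      simp only [_root_.smul_apply, innerSL_apply_apply, smul_eq_mul, nsmul_eq_mul,
        mul_inv]
      push_cast
      ring
    have := integral_mul_fderiv_eq_neg_fderiv_mul_of_integrable (μ := volume) (v := v)
      (f := fun z : Space d => greenProfile d (‖z‖ ^ 2 + ε)) (g := fun z => fderiv ℝ k z v)
      (by simp only [hfd]; exact (i1 v).const_mul _) (by simp only [hgd]; exact i2 v)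
      ((hfc.mul (hkd.clm_apply continuous_const)).integrable_of_hasCompactSupport (g1 v).mul_left)
      (fun z _ => (hf z).differentiableAt)
      (fun z _ => ((hk1.differentiable (by simp)).clm_apply (differentiable_const _)) z)
    simp only [hgd, hfd] at this
    rw [this, integral_const_mul]
    ring
  simp only [lap, Finset.mul_sum]
  rw [integral_finsetSum _ fun i _ => i2 _]
  simp only [key]
  rw [← Finset.mul_sum, ← integral_finsetSum _ fun i _ => i1 _]
  simp only [← Finset.mul_sum, inner_eq_sum_single]

theorem tendsto_integral_greenProfile {d : ℕ} (hd : 2 ≤ d) {g : Space d → ℝ} (hg : Continuous g)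
    (hc : HasCompactSupport g) :
    Tendsto (fun n : ℕ => ∫ z, greenProfile d (‖z‖ ^ 2 + 1 / ((n : ℝ) + 1)) * g z) atTop
      (𝓝 (∫ z, greenProfile d (‖z‖ ^ 2) * g z)) := by
  have : Nontrivial (Space d) :=
    Module.nontrivial_of_finrank_pos (R := ℝ) (by rw [finrank_euclideanSpace_fin]; omega)
  obtain ⟨R, hR⟩ := hc.isCompact.isBounded.subset_ball 0
  have hae : ∀ᵐ z : Space d, z ≠ 0 := by
    simp [ae_iff, measure_singleton]
  have hcont : ∀ ε : ℝ, 0 < ε → Continuous fun z : Space d => greenProfile d (‖z‖ ^ 2 + ε) :=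
    fun ε hε => continuous_iff_continuousAt.mpr fun z =>
      ((hasDerivAt_greenProfile hd (by positivity : 0 < ‖z‖ ^ 2 + ε)).continuousAt).comp
        (f := fun z : Space d => ‖z‖ ^ 2 + ε) (by fun_prop)
  have hsupp : ∀ (q : Space d → ℝ), IntegrableOn q (ball 0 R) →
      Integrable fun z => ‖q z‖ * ‖g z‖ := by
    intro q hq
    obtain ⟨C, hC⟩ := hg.bounded_above_of_compact_support hc
    have h1 : IntegrableOn (fun z => ‖q z‖ * ‖g z‖) (ball 0 R) :=
      hq.norm.mul_bdd (c := C) hg.norm.aestronglyMeasurable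
        (Eventually.of_forall fun z => by simpa using hC z)
    refine (integrableOn_iff_integrable_of_support_subset fun z hz => hR ?_).mp h1
    exact subset_tsupport g (norm_ne_zero_iff.mp (right_ne_zero_of_mul hz))
  refine tendsto_integral_of_dominated_convergence
    (fun z => ‖greenProfile d (‖z‖ ^ 2)‖ * ‖g z‖ + ‖greenProfile d (‖z‖ ^ 2 + 1)‖ * ‖g z‖)
    (fun n => ((hcont _ (by positivity)).mul hg).aestronglyMeasurable)
    ((hsupp _ (integrableOn_ball_greenProfile hd R)).add (hsupp _
      (((hcont 1 one_pos).continuousOn.integrableOn_compact (isCompact_closedBall 0 R)).mono_set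
        ball_subset_closedBall))) (fun n => ?_) ?_
  · filter_upwards [hae] with z hz
    have hz' : 0 < ‖z‖ ^ 2 := by positivity
    have hn : (0 : ℝ) < 1 / ((n : ℝ) + 1) := by positivity
    have hn1 : 1 / ((n : ℝ) + 1) ≤ 1 := by
      rw [div_le_one (by positivity)]; linarith [(Nat.cast_nonneg n : (0 : ℝ) ≤ n)]
    rw [norm_mul, ← add_mul]
    refine mul_le_mul_of_nonneg_right ?_ (norm_nonneg _)
    have ha := antitoneOn_greenProfile hd (mem_Ioi.mpr hz')
      (mem_Ioi.mpr (by positivity : 0 < ‖z‖ ^ 2 + 1 / ((n : ℝ) + 1))) (by linarith)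
    have hb := antitoneOn_greenProfile hd
      (mem_Ioi.mpr (by positivity : 0 < ‖z‖ ^ 2 + 1 / ((n : ℝ) + 1)))
      (mem_Ioi.mpr (by positivity : 0 < ‖z‖ ^ 2 + 1)) (by linarith)
    rw [Real.norm_eq_abs, Real.norm_eq_abs, Real.norm_eq_abs]
    refine abs_le.mpr ⟨?_, ?_⟩
    · linarith [neg_abs_le (greenProfile d (‖z‖ ^ 2 + 1)), abs_nonneg (greenProfile d (‖z‖ ^ 2))]
    · linarith [le_abs_self (greenProfile d (‖z‖ ^ 2)), abs_nonneg (greenProfile d (‖z‖ ^ 2 + 1))]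
  · filter_upwards [hae] with z hz
    have hz' : 0 < ‖z‖ ^ 2 := by positivity
    refine Tendsto.mul_const _ ?_
    refine (hasDerivAt_greenProfile hd hz').continuousAt.tendsto.comp ?_
    simpa using tendsto_one_div_add_atTop_nhds_zero_nat.const_add (‖z‖ ^ 2)

theorem integrable_radial_deriv {d : ℕ} (hd : 2 ≤ d) {k : Space d → ℝ} (hk : ContDiff ℝ 1 k)
    (hc : HasCompactSupport k) :
    Integrable fun z => (‖z‖ ^ (d - 1))⁻¹ * ‖fderiv ℝ k z‖ := by
  obtain ⟨R, hR⟩ := (hc.fderiv ℝ).isCompact.isBounded.subset_ball 0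
  have hkd : Continuous (fderiv ℝ k) := hk.continuous_fderiv (by simp)
  obtain ⟨C, hC⟩ := hkd.bounded_above_of_compact_support (hc.fderiv ℝ)
  have h0 : IntegrableOn (fun z : Space d => (‖z‖ ^ (d - 1))⁻¹) (ball 0 R) :=
    integrableOn_ball_norm_comp hd (p := fun y => (y ^ (d - 1))⁻¹) (q := fun _ => 1)
      continuous_const (fun y hy => mul_inv_cancel₀ (by positivity)) R
  have h1 : IntegrableOn (fun z : Space d => (‖z‖ ^ (d - 1))⁻¹ * ‖fderiv ℝ k z‖) (ball 0 R) :=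
    h0.mul_bdd (c := C) hkd.norm.aestronglyMeasurable (Eventually.of_forall fun z => by simpa using hC z)
  refine (integrableOn_iff_integrable_of_support_subset fun z hz => hR ?_).mp h1
  exact subset_tsupport (fderiv ℝ k) (norm_ne_zero_iff.mp (right_ne_zero_of_mul hz))

/-- The exponent `-d/2` is negative, so the weight is largest at `ε = 0`. There the integrand is
bounded by `‖z‖^(1-d) ‖dk‖`, which is integrable, and dominated convergence leads to the
polar-coordinate integral. -/
theorem tendsto_integral_radial_deriv {d : ℕ} (hd : 2 ≤ d) {k : Space d → ℝ} (hk : ContDiff ℝ 1 k)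
    (hc : HasCompactSupport k) :
    Tendsto (fun n : ℕ => ∫ z, (‖z‖ ^ 2 + 1 / ((n : ℝ) + 1)) ^ (-((d : ℝ) / 2)) * fderiv ℝ k z z)
      atTop (𝓝 (-(sphereVolume d * k 0))) := by
  have : Nontrivial (Space d) :=
    Module.nontrivial_of_finrank_pos (R := ℝ) (by rw [finrank_euclideanSpace_fin]; omega)
  have hkd : Continuous (fderiv ℝ k) := hk.continuous_fderiv (by simp)
  have hae : ∀ᵐ z : Space d, z ≠ 0 := by
    simp [ae_iff, measure_singleton]
  have hpow : ∀ z : Space d, z ≠ 0 → (‖z‖ ^ 2) ^ (-((d : ℝ) / 2)) = (‖z‖ ^ d)⁻¹ := by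
    intro z hz
    rw [Real.rpow_neg (by positivity), ← Real.rpow_natCast, ← Real.rpow_mul (norm_nonneg _),
      ← Real.rpow_natCast ‖z‖ d]
    congr 2
    push_cast
    ring
  have hbd : ∀ z : Space d, z ≠ 0 →
      ‖(‖z‖ ^ d)⁻¹ * fderiv ℝ k z z‖ ≤ (‖z‖ ^ (d - 1))⁻¹ * ‖fderiv ℝ k z‖ := by
    intro z hz
    have hz' : 0 < ‖z‖ := norm_pos_iff.mpr hz
    rw [norm_mul, norm_inv, norm_pow, norm_norm]
    calc (‖z‖ ^ d)⁻¹ * ‖fderiv ℝ k z z‖ ≤ (‖z‖ ^ d)⁻¹ * (‖fderiv ℝ k z‖ * ‖z‖) := by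
          gcongr; exact (fderiv ℝ k z).le_opNorm z
      _ = _ := by
          obtain ⟨e, rfl⟩ : ∃ e, d = e + 1 := ⟨d - 1, by omega⟩
          rw [Nat.add_sub_cancel, pow_succ]
          field_simp
  have hmeas : AEStronglyMeasurable fun z : Space d => (‖z‖ ^ d)⁻¹ * fderiv ℝ k z z :=
    ((measurable_norm.pow_const d).inv.aestronglyMeasurable).mul
      (hkd.clm_apply continuous_id).aestronglyMeasurable
  have hint : Integrable fun z : Space d => (‖z‖ ^ d)⁻¹ * fderiv ℝ k z z :=
    (integrable_radial_deriv hd hk hc).mono' hmeas (by filter_upwards [hae] with z hz using hbd z hz)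
  rw [← integral_radial_deriv hd hk hc hint]
  refine tendsto_integral_of_dominated_convergence
    (fun z => (‖z‖ ^ (d - 1))⁻¹ * ‖fderiv ℝ k z‖) (fun n => ?_)
    (integrable_radial_deriv hd hk hc) (fun n => ?_) ?_
  · refine ((Continuous.rpow_const (by fun_prop) fun z => Or.inl ?_).mul
      (hkd.clm_apply continuous_id)).aestronglyMeasurable
    positivity
  · filter_upwards [hae] with z hz
    refine le_trans ?_ (hbd z hz)
    rw [norm_mul, norm_mul, ← hpow z hz]
    refine mul_le_mul_of_nonneg_right ?_ (norm_nonneg _)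
    rw [Real.norm_of_nonneg (by positivity), Real.norm_of_nonneg (by positivity)]
    refine Real.rpow_le_rpow_of_nonpos (by positivity) ?_ ?_
    · have : (0 : ℝ) < 1 / ((n : ℝ) + 1) := by positivity
      linarith
    · have : (0 : ℝ) ≤ d := Nat.cast_nonneg d
      linarith
  · filter_upwards [hae] with z hz
    refine Tendsto.mul_const _ ?_
    rw [← hpow z hz]
    have hz' : ‖z‖ ^ 2 ≠ 0 := by positivity
    refine (Real.continuousAt_rpow_const _ _ (Or.inl hz')).tendsto.comp ?_
    simpa using tendsto_one_div_add_atTop_nhds_zero_nat.const_add (‖z‖ ^ 2)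

/-- The Green function is a fundamental solution of the Laplacian. -/
theorem integral_greenProfile_mul_lap {d : ℕ} (hd : 2 ≤ d) {k : Space d → ℝ} (hk : ContDiff ℝ 2 k)
    (hc : HasCompactSupport k) : ∫ z, greenProfile d (‖z‖ ^ 2) * lap k z = -k 0 := by
  have hω := sphereVolume_pos hd
  have hk1 : ContDiff ℝ 1 (fderiv ℝ k) := hk.fderiv_right (by norm_num)
  have c2 : HasCompactSupport (fderiv ℝ (fderiv ℝ k)) := (hc.fderiv ℝ).fderiv ℝ
  have hl : Continuous (lap k) := continuous_finsetSum _ fun i _ =>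
    ((hk1.continuous_fderiv (by simp)).clm_apply continuous_const).clm_apply continuous_const
  have hlc : HasCompactSupport (lap k) := c2.comp_left
    (g := fun L : Space d →L[ℝ] Space d →L[ℝ] ℝ =>
      ∑ i, L (EuclideanSpace.single i 1) (EuclideanSpace.single i 1)) (by simp)
  have h1 := tendsto_integral_greenProfile hd hl hlc
  have h2 := (tendsto_integral_radial_deriv hd (hk.of_le (by norm_num)) hc).const_mul
    (sphereVolume d)⁻¹
  have h3 : ∀ n : ℕ, ∫ z, greenProfile d (‖z‖ ^ 2 + 1 / ((n : ℝ) + 1)) * lap k z = _ :=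
    fun n => integral_regularized hd hk hc (by positivity)
  simp only [h3] at h1
  rw [tendsto_nhds_unique h1 h2]
  field_simp

end Fundamental

/-! ### From the fundamental solution to a Green kernel on `𝔻 × 𝔻`. -/

section GreenKernel

open Metric Set Filter Topology

variable {d : ℕ}

/-- The function `x ↦ F(x, y)` for a test function `F` on `𝔻 × 𝔻`. -/
noncomputable def slice (F : 𝓓(diskSq d, ℝ)) (y : Space d) : Test d :=
  have hsub : (Function.support fun x => F (x, y)) ⊆
      (fun x : Space d => (x, y)) ⁻¹' tsupport F := fun _ hx => subset_tsupport F hx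
  have hK : IsCompact ((fun x : Space d => (x, y)) ⁻¹' tsupport F) :=
    (F.hasCompactSupport.isCompact.image continuous_fst).of_isClosed_subset
      ((isClosed_tsupport F).preimage (by fun_prop)) fun x hx => ⟨(x, y), hx, rfl⟩
  { toFun := fun x => F (x, y)
    contDiff' := F.contDiff.comp (contDiff_id.prodMk contDiff_const)
    hasCompactSupport' := HasCompactSupport.of_support_subset_isCompact hK hsub
    tsupport_subset' := (closure_minimal hsub hK.isClosed).trans
      fun _ hx => (F.tsupport_subset hx).1 }

theorem slice_apply (F : 𝓓(diskSq d, ℝ)) (x y : Space d) : slice F y x = F (x, y) := rfl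

theorem lineDeriv_slice (F : 𝓓(diskSq d, ℝ)) (v y : Space d) :
    ∂_{v} (slice F y) = slice (∂_{((v, 0) : Space d × Space d)} F) y := by
  ext x
  rw [TestFunction.lineDerivOp_eq_lineDerivCLM ℝ, TestFunction.lineDerivCLM_apply_of_le (by simp),
    slice_apply, TestFunction.lineDerivOp_eq_lineDerivCLM ℝ,
    TestFunction.lineDerivCLM_apply_of_le (by simp)]
  simp [lineDeriv, slice_apply]

theorem laplace_slice (F : 𝓓(diskSq d, ℝ)) (x y : Space d) :
    laplace d (slice F y) x = laplaceFst d F (x, y) := by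
  simp [laplaceFst, laplace, lineDeriv_slice, slice_apply]

theorem test_eq_zero_of_notMem (f : Test d) {x : Space d} (hx : x ∉ (disk d : Set (Space d))) :
    f x = 0 := by
  by_contra h
  exact hx (f.tsupport_subset (subset_tsupport f h))

theorem setIntegral_disk_mul (f : Test d) (u : Space d → ℝ) :
    ∫ x in (disk d : Set (Space d)), u x * f x = ∫ x, u x * f x :=
  setIntegral_eq_integral_of_forall_compl_eq_zero fun x hx => by
    rw [test_eq_zero_of_notMem f hx, mul_zero]

theorem integrable_mul_testFunction {E : Type*} [NormedAddCommGroup E] [NormedSpace ℝ E]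
    [FiniteDimensional ℝ E] [MeasurableSpace E] [BorelSpace E] {μ : Measure E}
    {U : TopologicalSpace.Opens E} {P : E → ℝ} (hP : LocallyIntegrableOn P U μ) (F : 𝓓(U, ℝ)) :
    Integrable (fun p => P p * F p) μ := by
  have hK := F.hasCompactSupport.isCompact
  exact (integrableOn_iff_integrable_of_support_subset fun p hp =>
    subset_tsupport F (right_ne_zero_of_mul (Function.mem_support.mp hp))).mp
      ((hP.integrableOn_compact_subset F.tsupport_subset hK).mul_continuousOn
        F.continuous.continuousOn hK)

/-- A symmetric locally integrable kernel is a Green kernel if `Δ P(·, y) = δ_y` for all `y`. -/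
theorem isGreenKernel_of_forall_integral {P : Space d → Space d → ℝ}
    (symm : ∀ x ∈ disk d, ∀ y ∈ disk d, P x y = P y x)
    (hP : LocallyIntegrableOn (fun p : Space d × Space d => P p.1 p.2) (diskSq d))
    (h : ∀ y ∈ disk d, ∀ f : Test d,
      ∫ x in (disk d : Set (Space d)), P x y * laplace d f x = f y) : IsGreenKernel d P where
  symm := symm
  locallyIntegrable := hP
  fundamental F := by
    have hi := (integrable_mul_testFunction hP (laplaceFst d F)).integrableOn (s := diskSq d)
    change ∫ p in (disk d : Set (Space d)) ×ˢ (disk d : Set (Space d)), _ = _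
    -- With `y` as the outer variable, each slice `F(·, y)` is a test function on `𝔻`, to which the
    -- hypothesis applies.
    rw [Measure.volume_eq_prod, ← Measure.prod_restrict, integral_prod_symm]
    · refine setIntegral_congr_fun (disk d).isOpen.measurableSet fun y hy => ?_
      simp only [← laplace_slice]
      rw [h y hy, slice_apply]
    · rw [Measure.prod_restrict]
      exact hi

theorem lap_comp_add_right (f : Space d → ℝ) (y z : Space d) :
    lap (fun z => f (z + y)) z = lap f (z + y) := by
  have h : fderiv ℝ (fun z => f (z + y)) = fun z => fderiv ℝ f (z + y) :=
    funext fun z => fderiv_comp_add_right y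
  simp only [lap, h, fderiv_comp_add_right]

theorem integral_green_mul_laplace (hd : 2 ≤ d) (f : Test d) (y : Space d) :
    ∫ x in (disk d : Set (Space d)), green d x y * laplace d f x = f y := by
  rw [setIntegral_disk_mul, ← integral_add_right_eq_self _ y]
  simp only [green_eq_greenProfile hd, add_sub_cancel_right, laplace_apply, mul_neg,
    ← lap_comp_add_right]
  rw [integral_neg, integral_greenProfile_mul_lap hd (k := fun z => f (z + y))
    ((f.contDiff.of_le ENat.LEInfty.out).comp (contDiff_id.add contDiff_const))
    (f.hasCompactSupport.comp_homeomorph (Homeomorph.addRight y))]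
  simp

/-- On `𝔻 × 𝔻` the kernel is the integrand of a convolution of two integrable functions: the
indicator of the unit ball in `y`, and the profile in `x - y`, cut off at radius `2` because `‖x -
y‖ < 2`. -/
theorem integrableOn_green (hd : 2 ≤ d) :
    IntegrableOn (fun p : Space d × Space d => green d p.1 p.2) (diskSq d) := by
  have h1 : Integrable ((ball (0 : Space d) 2).indicator fun z => greenProfile d (‖z‖ ^ 2)) :=
    (integrable_indicator_iff measurableSet_ball).mpr (integrableOn_ball_greenProfile hd 2)
  have h2 : Integrable ((ball (0 : Space d) 1).indicator fun _ => (1 : ℝ)) :=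
    (integrable_indicator_iff measurableSet_ball).mpr
      (integrableOn_const measure_ball_lt_top.ne)
  have h3 := (h2.convolution_integrand (ContinuousLinearMap.mul ℝ ℝ) h1).integrableOn (s := diskSq d)
  refine IntegrableOn.congr_fun h3 (fun p hp => ?_) (diskSq d).isOpen.measurableSet
  have hp1 : ‖p.1‖ < 1 := mem_ball_zero_iff.mp hp.1
  have hp2 : ‖p.2‖ < 1 := mem_ball_zero_iff.mp hp.2
  have h4 : p.1 - p.2 ∈ ball (0 : Space d) 2 := by
    rw [mem_ball_zero_iff]
    linarith [norm_sub_le p.1 p.2]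
  simp only [indicator_of_mem h4, ContinuousLinearMap.mul_apply', green_eq_greenProfile hd]
  rw [indicator_of_mem (s := ball (0 : Space d) 1) hp.2, one_mul]

theorem isGreenKernel_green (hd : 2 ≤ d) : IsGreenKernel d (green d) :=
  isGreenKernel_of_forall_integral
    (fun x _ y _ => by rw [green_eq_greenProfile hd, green_eq_greenProfile hd, norm_sub_rev])
    (integrableOn_green hd).locallyIntegrableOn
    fun y _ f => integral_green_mul_laplace hd f y

end GreenKernel

/-! ### Product rule, chain rule and symmetry for higher derivatives. -/

section SecondDerivatives

open Filter Topology

variable {E F : Type*} [NormedAddCommGroup E] [NormedSpace ℝ E] [NormedAddCommGroup F]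
  [NormedSpace ℝ F]

theorem eventually_differentiableAt {f : E → F} {x : E} (hf : ContDiffAt ℝ 2 f x) :
    ∀ᶠ y in 𝓝 x, DifferentiableAt ℝ f y := by
  filter_upwards [hf.eventually (by simp)] with y hy using hy.differentiableAt (by simp)

theorem differentiableAt_fderiv {f : E → F} {x : E} (hf : ContDiffAt ℝ 2 f x) :
    DifferentiableAt ℝ (fderiv ℝ f) x :=
  (hf.fderiv_right (m := 1) (by norm_num)).differentiableAt (by simp)

theorem fderiv_fderiv_apply {f : E → F} {x : E} (hf : ContDiffAt ℝ 2 f x) (u v : E) :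
    fderiv ℝ (fderiv ℝ f) x u v = fderiv ℝ (fun y => fderiv ℝ f y v) x u := by
  rw [fderiv_clm_apply (differentiableAt_fderiv hf) (differentiableAt_const _)]
  simp

theorem fderiv_fderiv_comm {f : E → F} {x : E} (hf : ContDiffAt ℝ 2 f x) (u v : E) :
    fderiv ℝ (fderiv ℝ f) x u v = fderiv ℝ (fderiv ℝ f) x v u :=
  hf.isSymmSndFDerivAt (by simp) u v

theorem fderiv_fderiv_smul {a : E → ℝ} {b : E → F} {x : E} (ha : ContDiffAt ℝ 2 a x)
    (hb : ContDiffAt ℝ 2 b x) (u v : E) :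
    fderiv ℝ (fderiv ℝ fun y => a y • b y) x u v =
      a x • fderiv ℝ (fderiv ℝ b) x u v + fderiv ℝ a x u • fderiv ℝ b x v +
        fderiv ℝ a x v • fderiv ℝ b x u + fderiv ℝ (fderiv ℝ a) x u v • b x := by
  have h : (fun y => fderiv ℝ (fun y => a y • b y) y v) =ᶠ[𝓝 x]
      fun y => a y • fderiv ℝ b y v + fderiv ℝ a y v • b y := by
    filter_upwards [eventually_differentiableAt ha, eventually_differentiableAt hb] with y h1 h2
    rw [fderiv_fun_smul h1 h2]
    simp
  have ha1 := ha.differentiableAt (by simp)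
  have hb1 := hb.differentiableAt (by simp)
  have ha2 := (differentiableAt_fderiv ha).clm_apply (differentiableAt_const v)
  have hb2 := (differentiableAt_fderiv hb).clm_apply (differentiableAt_const v)
  have h' : HasFDerivAt (fun y => a y • fderiv ℝ b y v + fderiv ℝ a y v • b y) _ x :=
    (ha1.hasFDerivAt.smul hb2.hasFDerivAt).add (ha2.hasFDerivAt.smul hb1.hasFDerivAt)
  rw [fderiv_fderiv_apply (f := fun y => a y • b y) (ha.smul hb), h.fderiv_eq, h'.fderiv,
    fderiv_fderiv_apply ha, fderiv_fderiv_apply hb]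
  simp only [_root_.add_apply, _root_.smul_apply, ContinuousLinearMap.smulRight_apply]
  abel

theorem fderiv_fderiv_comp {G : Type*} [NormedAddCommGroup G] [NormedSpace ℝ G] {k : F → G}
    {f : E → F} {x : E} (hk : ContDiffAt ℝ 2 k (f x)) (hf : ContDiffAt ℝ 2 f x) (u v : E) :
    fderiv ℝ (fderiv ℝ fun y => k (f y)) x u v =
      fderiv ℝ (fderiv ℝ k) (f x) (fderiv ℝ f x u) (fderiv ℝ f x v) +
        fderiv ℝ k (f x) (fderiv ℝ (fderiv ℝ f) x u v) := by
  have h : (fun y => fderiv ℝ (fun y => k (f y)) y v) =ᶠ[𝓝 x]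
      fun y => fderiv ℝ k (f y) (fderiv ℝ f y v) := by
    filter_upwards [eventually_differentiableAt hf,
      hf.continuousAt.eventually (eventually_differentiableAt hk)] with y h1 h2
    rw [fderiv_fun_comp y h2 h1]
    rfl
  have hk2 : DifferentiableAt ℝ (fun y => fderiv ℝ k (f y)) x :=
    DifferentiableAt.comp x (differentiableAt_fderiv hk) (hf.differentiableAt (by simp))
  have hf2 := (differentiableAt_fderiv hf).clm_apply (differentiableAt_const v)
  rw [fderiv_fderiv_apply (f := fun y => k (f y)) (hk.comp x hf), h.fderiv_eq, fderiv_clm_apply hk2 hf2,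
    fderiv_fun_comp x (differentiableAt_fderiv hk) (hf.differentiableAt (by simp)),
    fderiv_fderiv_apply hf]
  simp [add_comm]

theorem fderiv_fderiv_norm_sub_sq {E' : Type*} [NormedAddCommGroup E'] [InnerProductSpace ℝ E']
    {f : E → E'} {x : E} (hf : ContDiffAt ℝ 2 f x) (p : E') (u v : E) :
    fderiv ℝ (fderiv ℝ fun y => ‖f y - p‖ ^ 2) x u v =
      2 * inner ℝ (f x - p) (fderiv ℝ (fderiv ℝ f) x u v) +
        2 * inner ℝ (fderiv ℝ f x u) (fderiv ℝ f x v) := by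
  have h : (fun y => fderiv ℝ (fun y => ‖f y - p‖ ^ 2) y v) =ᶠ[𝓝 x]
      fun y => 2 * inner ℝ (f y - p) (fderiv ℝ f y v) := by
    filter_upwards [eventually_differentiableAt hf] with y h1
    rw [((h1.hasFDerivAt.sub_const p).norm_sq).fderiv]
    simp [inner_sub_left]
  have hf1 := hf.differentiableAt (by simp)
  have hf2 := (differentiableAt_fderiv hf).clm_apply (differentiableAt_const v)
  rw [fderiv_fderiv_apply ((hf.sub contDiffAt_const).norm_sq ℝ), h.fderiv_eq,
    fderiv_const_mul ((hf1.sub_const p).inner ℝ hf2), _root_.smul_apply,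
    fderiv_inner_apply ℝ (hf1.sub_const p) hf2, fderiv_sub_const, fderiv_fderiv_apply hf]
  simp [mul_add]

theorem fderiv_norm_sub_sq_apply {E' : Type*} [NormedAddCommGroup E'] [InnerProductSpace ℝ E']
    {f : E → E'} {x : E} (hf : DifferentiableAt ℝ f x) (p : E') (u : E) :
    fderiv ℝ (fun y => ‖f y - p‖ ^ 2) x u = 2 * inner ℝ (f x - p) (fderiv ℝ f x u) := by
  rw [((hf.hasFDerivAt.sub_const p).norm_sq).fderiv]
  simp [inner_sub_left]

/-- Third derivatives are symmetric in the first two arguments. -/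
theorem fderiv_fderiv_fderiv_comm {f : E → F} {x : E} (hf : ContDiffAt ℝ 3 f x) (t u v : E) :
    fderiv ℝ (fun y => fderiv ℝ (fderiv ℝ f) y u v) x t =
      fderiv ℝ (fun y => fderiv ℝ (fderiv ℝ f) y t v) x u := by
  have h1 : ContDiffAt ℝ 2 (fderiv ℝ f) x := hf.fderiv_right (by norm_num)
  have h2 := differentiableAt_fderiv h1
  have h : ∀ u t : E, fderiv ℝ (fun y => fderiv ℝ (fderiv ℝ f) y u v) x t =
      fderiv ℝ (fderiv ℝ (fderiv ℝ f)) x t u v := by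
    intro u t
    rw [fderiv_clm_apply (h2.clm_apply (differentiableAt_const u)) (differentiableAt_const v),
      fderiv_clm_apply h2 (differentiableAt_const u)]
    simp
  rw [h, h, fderiv_fderiv_comm h1]

end SecondDerivatives

/-! ### Functions whose Hessian is proportional to the metric. -/

section Umbilic

open Filter Topology

variable {E : Type*} [NormedAddCommGroup E] [InnerProductSpace ℝ E]

/-- The vectors `w + ‖w‖ e` and `w - ‖w‖ e` are orthogonal, which gives `b w w = b e e ‖w‖²`;
polarization does the rest. -/
theorem bilin_eq_of_orthogonal {b : E →L[ℝ] E →L[ℝ] ℝ} (hs : ∀ u v, b u v = b v u)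
    (h : ∀ u v, inner ℝ u v = (0 : ℝ) → b u v = 0) {e : E} (he : ‖e‖ = 1) (u v : E) :
    b u v = b e e * inner ℝ u v := by
  have hdiag : ∀ w : E, b w w = b e e * ‖w‖ ^ 2 := by
    intro w
    have h1 := h (w + ‖w‖ • e) (w - ‖w‖ • e) (by
      simp only [inner_add_left, inner_sub_right, real_inner_smul_left, real_inner_smul_right,
        real_inner_self_eq_norm_sq, real_inner_comm e w, norm_smul, norm_norm, he]
      ring)
    simp only [map_add, map_sub, map_smul, _root_.add_apply, _root_.smul_apply, smul_eq_mul,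
      hs e w] at h1
    linarith
  have h2 := hdiag (u + v)
  rw [norm_add_sq_real] at h2
  simp only [map_add, _root_.add_apply, hs v u] at h2
  rw [hdiag u, hdiag v] at h2
  linarith

/-- A function on a convex open set whose second derivative vanishes on orthogonal pairs, and which
has a critical zero, is a multiple of the squared distance from that point. -/
theorem eq_norm_sq_of_umbilic {s : Set E} (hs : IsOpen s) (hc : Convex ℝ s)
    (hdim : ∀ u : E, ∃ t : E, ‖t‖ = 1 ∧ inner ℝ u t = (0 : ℝ)) {f : E → ℝ}
    (hf : ContDiffOn ℝ 3 f s)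
    (h : ∀ x ∈ s, ∀ u v : E, inner ℝ u v = (0 : ℝ) → fderiv ℝ (fderiv ℝ f) x u v = 0)
    {y : E} (hy : y ∈ s) (h0 : f y = 0) (h1 : fderiv ℝ f y = 0) {e : E} (he : ‖e‖ = 1) :
    ∀ x ∈ s, f x = fderiv ℝ (fderiv ℝ f) y e e / 2 * ‖x - y‖ ^ 2 := by
  have hfa : ∀ x ∈ s, ContDiffAt ℝ 3 f x := fun x hx => hf.contDiffAt (hs.mem_nhds hx)
  have hfa2 : ∀ x ∈ s, ContDiffAt ℝ 2 f x := fun x hx => (hfa x hx).of_le (by norm_num)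
  have hb : ∀ e : E, ‖e‖ = 1 → ∀ x ∈ s, ∀ u v : E,
      fderiv ℝ (fderiv ℝ f) x u v = fderiv ℝ (fderiv ℝ f) x e e * inner ℝ u v :=
    fun e he x hx => bilin_eq_of_orthogonal (fderiv_fderiv_comm (hfa2 x hx)) (h x hx) he
  have hd2 : ∀ x ∈ s, ∀ u v, DifferentiableAt ℝ (fun x => fderiv ℝ (fderiv ℝ f) x u v) x :=
    fun x hx u v => ((differentiableAt_fderiv ((hfa x hx).fderiv_right
      (by norm_num))).clm_apply (differentiableAt_const u)).clm_apply (differentiableAt_const v)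
  -- The Hessian takes the same value on all unit vectors, so its derivative along `t` may be
  -- computed with a unit vector `r ⊥ t`. Symmetry of `f'''` turns `∂_t f''(r, r)` into `∂_r f''(t,
  -- r)`, and `f''(t, r)` vanishes near `x`.
  have hconst : ∀ x ∈ s, fderiv ℝ (fun x => fderiv ℝ (fderiv ℝ f) x e e) x = 0 := by
    intro x hx
    ext t
    obtain ⟨r, hr, hrt⟩ := hdim t
    have e1 : (fun x => fderiv ℝ (fderiv ℝ f) x e e) =ᶠ[𝓝 x]
        fun x => fderiv ℝ (fderiv ℝ f) x r r := by
      filter_upwards [hs.mem_nhds hx] with z hz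
      rw [hb e he z hz r r, real_inner_self_eq_norm_sq, hr]
      ring
    have e2 : (fun x => fderiv ℝ (fderiv ℝ f) x t r) =ᶠ[𝓝 x] fun _ => 0 := by
      filter_upwards [hs.mem_nhds hx] with z hz using h z hz t r hrt
    rw [e1.fderiv_eq, fderiv_fderiv_fderiv_comm (hfa x hx), e2.fderiv_eq]
    simp
  set ν : ℝ := fderiv ℝ (fderiv ℝ f) y e e with hν
  have hν' : ∀ x ∈ s, fderiv ℝ (fderiv ℝ f) x e e = ν := fun x hx =>
    hs.eqOn_of_fderiv_eq hc.isPreconnected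
      (fun x hx => (hd2 x hx e e).differentiableWithinAt) (differentiableOn_const ν)
      (fun x hx => by rw [hconst x hx]; simp) hy rfl hx
  -- The Hessian is now `ν` times the metric with `ν` constant; two integrations from the critical
  -- zero `y` recover `f`.
  have hgrad : ∀ x ∈ s, fderiv ℝ f x = ν • innerSL ℝ (x - y) := by
    have hl : ∀ x, HasFDerivAt (fun x => ν • innerSL ℝ (x - y))
        (ν • innerSL ℝ : E →L[ℝ] E →L[ℝ] ℝ) x := fun x =>
      ((innerSL ℝ : E →L[ℝ] E →L[ℝ] ℝ).hasFDerivAt.comp x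
        ((hasFDerivAt_id x).sub_const y)).const_smul ν
    refine hs.eqOn_of_fderiv_eq hc.isPreconnected
      (fun x hx => (differentiableAt_fderiv (hfa2 x hx)).differentiableWithinAt)
      (fun x _ => (hl x).differentiableAt.differentiableWithinAt) (fun x hx => ?_) hy (by simp [h1])
    rw [(hl x).fderiv]
    ext u v
    rw [hb e he x hx, hν' x hx]
    rfl
  have hq : ∀ x, HasFDerivAt (fun x => ν / 2 * ‖x - y‖ ^ 2) (ν • innerSL ℝ (x - y)) x := by
    intro x
    refine ((((hasFDerivAt_id x).sub_const y).norm_sq).const_mul (ν / 2)).congr_fderiv ?_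
    ext u
    simp
    ring
  refine hs.eqOn_of_fderiv_eq hc.isPreconnected
    (fun x hx => ((hfa x hx).differentiableAt (by simp)).differentiableWithinAt)
    (fun x _ => (hq x).differentiableAt.differentiableWithinAt) (fun x hx => ?_) hy (by simp [h0])
  rw [hgrad x hx, (hq x).fderiv]

end Umbilic

/-- Two vectors span at most a plane, so a direction is left over once `d ≥ 3`. This is where the
dimension enters Liouville's theorem. -/
theorem exists_ne_zero_orthogonal {d : ℕ} (hd : 3 ≤ d) (u v : Space d) :
    ∃ t : Space d, t ≠ 0 ∧ inner ℝ u t = (0 : ℝ) ∧ inner ℝ v t = (0 : ℝ) := by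
  set S := Submodule.span ℝ (Set.range ![u, v]) with hS
  have h1 : Module.finrank ℝ S ≤ 2 := by
    simpa [Set.finrank] using finrank_range_le_card (R := ℝ) ![u, v]
  have h2 := S.finrank_add_finrank_orthogonal
  rw [finrank_euclideanSpace_fin] at h2
  have h3 : Sᗮ ≠ ⊥ := by
    intro h
    rw [h, finrank_bot] at h2
    omega
  obtain ⟨t, ht, ht0⟩ := Submodule.exists_mem_ne_zero_of_ne_bot h3
  rw [Submodule.mem_orthogonal] at ht
  exact ⟨t, ht0, ht u (Submodule.subset_span ⟨0, rfl⟩), ht v (Submodule.subset_span ⟨1, rfl⟩)⟩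

/-! ### Derivatives of conformal maps and Liouville's theorem. -/

namespace ConformalEmbedding

open Filter Topology

variable {d : ℕ} (φ : ConformalEmbedding d) {x : Space d}

theorem disk_mem_nhds (hx : x ∈ disk d) : (disk d : Set (Space d)) ∈ 𝓝 x :=
  (disk d).isOpen.mem_nhds hx

theorem contDiffAt (hx : x ∈ disk d) : ContDiffAt ℝ ∞ φ.toFun x :=
  φ.contDiffOn.contDiffAt (disk_mem_nhds hx)

theorem contDiffAt_factor (hx : x ∈ disk d) : ContDiffAt ℝ ∞ φ.factor x :=
  φ.contDiffOn_factor.contDiffAt (disk_mem_nhds hx)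

theorem hasFDerivAt (hx : x ∈ disk d) : HasFDerivAt φ.toFun (fderiv ℝ φ.toFun x) x :=
  ((φ.contDiffAt hx).differentiableAt (by simp)).hasFDerivAt

/-- The isometry `Ω⁻¹ dφ`. -/
noncomputable def frame (hx : x ∈ disk d) : Space d ≃ₗᵢ[ℝ] Space d :=
  LinearIsometry.toLinearIsometryEquiv
    { toLinearMap := ((φ.factor x)⁻¹ • fderiv ℝ φ.toFun x : Space d →L[ℝ] Space d).toLinearMap
      norm_map' := fun u => by
        have hΩ := φ.factor_pos x hx
        have h := φ.conformal x hx u u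
        rw [real_inner_self_eq_norm_sq, real_inner_self_eq_norm_sq, ← mul_pow] at h
        have h' := (sq_eq_sq₀ (norm_nonneg _) (by positivity)).mp h
        change ‖(φ.factor x)⁻¹ • fderiv ℝ φ.toFun x u‖ = ‖u‖
        rw [norm_smul, h', norm_inv, Real.norm_of_nonneg hΩ.le]
        field_simp } rfl

theorem fderiv_apply_eq_frame (hx : x ∈ disk d) (u : Space d) :
    fderiv ℝ φ.toFun x u = φ.factor x • φ.frame hx u := by
  have hΩ := φ.factor_pos x hx
  change _ = φ.factor x • (φ.factor x)⁻¹ • fderiv ℝ φ.toFun x u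
  rw [smul_smul, mul_inv_cancel₀ hΩ.ne', one_smul]

/-- Since `dφ` is `Ω` times an isometry, its determinant is `±Ω^d`; preservation of orientation
decides the sign. -/
theorem det_fderiv (hx : x ∈ disk d) : (fderiv ℝ φ.toFun x).det = φ.factor x ^ d := by
  have hΩ := φ.factor_pos x hx
  have h : (fderiv ℝ φ.toFun x).toLinearMap =
      φ.factor x • (φ.frame hx).toLinearIsometry.toLinearMap :=
    LinearMap.ext (φ.fderiv_apply_eq_frame hx)
  have h1 := LinearMap.normDet_eq_abs_det (fderiv ℝ φ.toFun x).toLinearMap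
  have h2 := (φ.frame hx).toLinearIsometry.normDet_eq_one
  rw [h, LinearMap.normDet_smul, h2, ← h, finrank_euclideanSpace_fin, mul_one,
    Real.norm_of_nonneg hΩ.le] at h1
  rw [h1]
  exact (abs_of_pos (φ.orientation x hx)).symm

theorem ext_inner_fderiv (hx : x ∈ disk d) {a b : Space d}
    (h : ∀ w, inner ℝ a (fderiv ℝ φ.toFun x w) = (inner ℝ b (fderiv ℝ φ.toFun x w) : ℝ)) :
    a = b := by
  refine ext_inner_right ℝ fun v => ?_
  obtain ⟨w, rfl⟩ := (φ.frame hx).surjective v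
  have := h w
  rw [φ.fderiv_apply_eq_frame hx, real_inner_smul_right, real_inner_smul_right] at this
  exact mul_left_cancel₀ (φ.factor_pos x hx).ne' this

/-- The differential of the metric. -/
theorem inner_fderiv_fderiv_add (hx : x ∈ disk d) (w u v : Space d) :
    inner ℝ (fderiv ℝ φ.toFun x u) (fderiv ℝ (fderiv ℝ φ.toFun) x w v) +
      inner ℝ (fderiv ℝ (fderiv ℝ φ.toFun) x w u) (fderiv ℝ φ.toFun x v) =
        2 * φ.factor x * fderiv ℝ φ.factor x w * inner ℝ u v := by
  have h2 : ContDiffAt ℝ 2 φ.toFun x := (φ.contDiffAt hx).of_le ENat.LEInfty.out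
  have h : (fun y => inner ℝ (fderiv ℝ φ.toFun y u) (fderiv ℝ φ.toFun y v)) =ᶠ[𝓝 x]
      fun y => φ.factor y ^ 2 * (inner ℝ u v : ℝ) := by
    filter_upwards [disk_mem_nhds hx] with y hy using φ.conformal y hy u v
  have hd := fun v => (differentiableAt_fderiv h2).clm_apply (differentiableAt_const (c := v))
  rw [fderiv_fderiv_apply h2, fderiv_fderiv_apply h2, ← fderiv_inner_apply ℝ (hd u) (hd v),
    h.fderiv_eq]
  have hf := ((φ.contDiffAt_factor hx).differentiableAt (by simp)).hasFDerivAt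
  rw [((hf.pow 2).mul_const _).fderiv]
  simp
  ring

/-- As for the Christoffel symbols: of the three arrangements of the differentiated metric, two are
added and one subtracted, and the symmetry of `φ''` leaves a single term. -/
theorem inner_fderiv_fderiv (hx : x ∈ disk d) (u v w : Space d) :
    inner ℝ (fderiv ℝ (fderiv ℝ φ.toFun) x u v) (fderiv ℝ φ.toFun x w) =
      φ.factor x * (fderiv ℝ φ.factor x u * inner ℝ v w + fderiv ℝ φ.factor x v * inner ℝ u w -
        fderiv ℝ φ.factor x w * inner ℝ u v) := by
  have h2 : ContDiffAt ℝ 2 φ.toFun x := (φ.contDiffAt hx).of_le ENat.LEInfty.out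
  have e1 := φ.inner_fderiv_fderiv_add hx u v w
  have e2 := φ.inner_fderiv_fderiv_add hx v u w
  have e3 := φ.inner_fderiv_fderiv_add hx w u v
  rw [fderiv_fderiv_comm h2 v u] at e2
  rw [fderiv_fderiv_comm h2 w u, fderiv_fderiv_comm h2 w v,
    real_inner_comm _ (fderiv ℝ (fderiv ℝ φ.toFun) x u w)] at e3
  linarith

/-- The inverse conformal factor. -/
noncomputable def invFactor (y : Space d) : ℝ := (φ.factor y)⁻¹

theorem contDiffAt_invFactor (hx : x ∈ disk d) : ContDiffAt ℝ ∞ φ.invFactor x :=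
  (φ.contDiffAt_factor hx).inv (φ.factor_pos x hx).ne'

theorem fderiv_factor (hx : x ∈ disk d) (u : Space d) :
    fderiv ℝ φ.factor x u = -(φ.factor x ^ 2 * fderiv ℝ φ.invFactor x u) := by
  have hΩ := φ.factor_pos x hx
  have hf := ((φ.contDiffAt_factor hx).differentiableAt (by simp)).hasFDerivAt
  have : HasFDerivAt φ.invFactor _ x := (hasDerivAt_inv hΩ.ne').comp_hasFDerivAt x hf
  rw [this.fderiv]
  simp
  field_simp

/-- The second derivative of a conformal map. -/
theorem fderiv_fderiv_eq (hx : x ∈ disk d) (u v : Space d) :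
    φ.invFactor x • fderiv ℝ (fderiv ℝ φ.toFun) x u v =
      (inner ℝ u v : ℝ) • fderiv ℝ φ.toFun x
          ((InnerProductSpace.toDual ℝ (Space d)).symm (fderiv ℝ φ.invFactor x)) -
        fderiv ℝ φ.invFactor x u • fderiv ℝ φ.toFun x v -
        fderiv ℝ φ.invFactor x v • fderiv ℝ φ.toFun x u := by
  have hΩ := φ.factor_pos x hx
  refine φ.ext_inner_fderiv hx fun w => ?_
  simp only [inner_sub_left, real_inner_smul_left, φ.conformal x hx, φ.inner_fderiv_fderiv hx,
    φ.fderiv_factor hx, InnerProductSpace.toDual_symm_apply, invFactor]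
  field_simp
  ring

/-- Let `g` be the gradient of `1/Ω`. In the trace of the formula for `φ''` the metric term
contributes `d · dφ(g)` and the two others `-dφ(g)` each, so everything cancels exactly because `d =
2`: planar conformal maps are harmonic. -/
theorem sum_fderiv_fderiv_eq_zero (φ : ConformalEmbedding 2) {x : Space 2} (hx : x ∈ disk 2) :
    ∑ i, fderiv ℝ (fderiv ℝ φ.toFun) x (EuclideanSpace.single i 1) (EuclideanSpace.single i 1) =
      0 := by
  have hΩ : φ.invFactor x ≠ 0 := (inv_pos.mpr (φ.factor_pos x hx)).ne'
  refine (smul_eq_zero_iff_right hΩ).mp ?_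
  set g := (InnerProductSpace.toDual ℝ (Space 2)).symm (fderiv ℝ φ.invFactor x) with hg
  have hsum : ∑ i, fderiv ℝ φ.invFactor x (EuclideanSpace.single i 1) •
      EuclideanSpace.single i (1 : ℝ) = g := by
    conv_rhs => rw [← (EuclideanSpace.basisFun (Fin 2) ℝ).sum_repr' g]
    refine Finset.sum_congr rfl fun i _ => ?_
    rw [EuclideanSpace.basisFun_apply, real_inner_comm, hg, InnerProductSpace.toDual_symm_apply]
  have hA : ∑ i, fderiv ℝ φ.invFactor x (EuclideanSpace.single i 1) •
      fderiv ℝ φ.toFun x (EuclideanSpace.single i (1 : ℝ)) = fderiv ℝ φ.toFun x g := by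
    rw [← hsum, map_sum]
    simp
  rw [Finset.smul_sum]
  simp only [φ.fderiv_fderiv_eq hx, Finset.sum_sub_distrib, hA]
  simp
  module

/-- A trace can be computed in any orthonormal basis, and the vectors `Ω⁻¹ dφ(eᵢ)` form one. -/
theorem sum_bilin_frame (hx : x ∈ disk d) (L : Space d →L[ℝ] Space d →L[ℝ] ℝ) :
    ∑ i, L (fderiv ℝ φ.toFun x (EuclideanSpace.single i 1))
        (fderiv ℝ φ.toFun x (EuclideanSpace.single i 1)) =
      φ.factor x ^ 2 * ∑ i, L (EuclideanSpace.single i 1) (EuclideanSpace.single i 1) := by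
  have h := (InnerProductSpace.canonicalCovariantTensor_eq_sum (Space d)
      ((EuclideanSpace.basisFun (Fin d) ℝ).map (φ.frame hx))).symm.trans
    (InnerProductSpace.canonicalCovariantTensor_eq_sum (Space d) (EuclideanSpace.basisFun (Fin d) ℝ))
  have h' := congrArg (TensorProduct.lift
    (ContinuousLinearMap.coeLM ℝ ∘ₗ L.toLinearMap : Space d →ₗ[ℝ] Space d →ₗ[ℝ] ℝ)) h
  simp only [map_sum, OrthonormalBasis.map_apply, EuclideanSpace.basisFun_apply,
    TensorProduct.lift.tmul] at h'
  simp only [φ.fderiv_apply_eq_frame hx, map_smul, _root_.smul_apply, smul_eq_mul, Finset.mul_sum,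
    ← mul_assoc, ← sq]
  rw [← Finset.mul_sum, ← Finset.mul_sum]
  exact congrArg _ h'

/-- Harmonicity of `φ` removes the first-order term of the chain rule, and the trace of the Hessian
scales by `Ω²`. -/
theorem lap_comp (φ : ConformalEmbedding 2) {x : Space 2} (hx : x ∈ disk 2) {k : Space 2 → ℝ}
    (hk : ContDiffAt ℝ 2 k (φ.toFun x)) :
    lap (fun y => k (φ.toFun y)) x = φ.factor x ^ 2 * lap k (φ.toFun x) := by
  have h2 : ContDiffAt ℝ 2 φ.toFun x := (φ.contDiffAt hx).of_le ENat.LEInfty.out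
  simp only [lap, fderiv_fderiv_comp hk h2, Finset.sum_add_distrib, ← map_sum,
    φ.sum_fderiv_fderiv_eq_zero hx, map_zero, add_zero]
  exact φ.sum_bilin_frame hx _

/-- Liouville's theorem, infinitesimal form. -/
theorem fderiv_fderiv_invFactor_eq_zero (hd : 3 ≤ d) (hx : x ∈ disk d) {u v : Space d}
    (huv : inner ℝ u v = (0 : ℝ)) : fderiv ℝ (fderiv ℝ φ.invFactor) x u v = 0 := by
  have h3 : ∀ y ∈ disk d, ContDiffAt ℝ 3 (fun y => φ.invFactor y • φ.toFun y) y := fun y hy =>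
    ((φ.contDiffAt_invFactor hy).smul (φ.contDiffAt hy)).of_le ENat.LEInfty.out
  -- With `λ = 1/Ω` and `u ⊥ v`, the formula for `λ φ''` cancels the mixed terms of the product rule
  -- for `λφ`.
  have hΦ : ∀ y ∈ disk d, ∀ u v : Space d, inner ℝ u v = (0 : ℝ) →
      fderiv ℝ (fderiv ℝ fun y => φ.invFactor y • φ.toFun y) y u v =
        fderiv ℝ (fderiv ℝ φ.invFactor) y u v • φ.toFun y := by
    intro y hy u v huv
    rw [fderiv_fderiv_smul ((φ.contDiffAt_invFactor hy).of_le ENat.LEInfty.out)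
      ((φ.contDiffAt hy).of_le ENat.LEInfty.out), φ.fderiv_fderiv_eq hy, huv]
    module
  have hl3 : ContDiffAt ℝ 3 φ.invFactor x := (φ.contDiffAt_invFactor hx).of_le ENat.LEInfty.out
  have hdl : ∀ u v : Space d,
      DifferentiableAt ℝ (fun y => fderiv ℝ (fderiv ℝ φ.invFactor) y u v) x := fun u v =>
    ((differentiableAt_fderiv (hl3.fderiv_right (by norm_num))).clm_apply
      (differentiableAt_const u)).clm_apply (differentiableAt_const v)
  have hderiv : ∀ t u v : Space d, inner ℝ u v = (0 : ℝ) →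
      fderiv ℝ (fun y => fderiv ℝ (fderiv ℝ fun y => φ.invFactor y • φ.toFun y) y u v) x t =
        fderiv ℝ (fderiv ℝ φ.invFactor) x u v • fderiv ℝ φ.toFun x t +
          fderiv ℝ (fun y => fderiv ℝ (fderiv ℝ φ.invFactor) y u v) x t • φ.toFun x := by
    intro t u v huv
    have h : (fun y => fderiv ℝ (fderiv ℝ fun y => φ.invFactor y • φ.toFun y) y u v) =ᶠ[𝓝 x]
        fun y => fderiv ℝ (fderiv ℝ φ.invFactor) y u v • φ.toFun y := by
      filter_upwards [disk_mem_nhds hx] with y hy using hΦ y hy u v huv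
    rw [h.fderiv_eq, fderiv_fun_smul (hdl u v) (φ.hasFDerivAt hx).differentiableAt]
    simp
  obtain ⟨t, ht0, htu, htv⟩ := exists_ne_zero_orthogonal hd u v
  -- Exchanging `t` and `u` in the third derivatives of `λφ` and of `λ` leaves `λ''(u, v) dφ(t) =
  -- λ''(t, v) dφ(u)`. Pairing with `dφ(t)` annihilates the right side, since `t ⊥ u`.
  have h := fderiv_fderiv_fderiv_comm (h3 x hx) t u v
  rw [hderiv t u v huv, hderiv u t v (by rw [real_inner_comm]; exact htv),
    fderiv_fderiv_fderiv_comm hl3 t u v, add_left_inj] at h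
  have h' := congrArg (fun a => (inner ℝ a (fderiv ℝ φ.toFun x t) : ℝ)) h
  simp only [real_inner_smul_left, φ.conformal x hx, htu, mul_zero] at h'
  have hΩ := φ.factor_pos x hx
  have htt : (inner ℝ t t : ℝ) ≠ 0 := inner_self_ne_zero.mpr ht0
  rcases mul_eq_zero.mp h' with h' | h'
  · exact h'
  · exact absurd h' (mul_ne_zero (by positivity) htt)

/-- The two-point form of Liouville's theorem. -/
theorem norm_sub_sq_eq (hd : 3 ≤ d) {y : Space d} (hx : x ∈ disk d) (hy : y ∈ disk d) :
    ‖φ.toFun x - φ.toFun y‖ ^ 2 = φ.factor x * φ.factor y * ‖x - y‖ ^ 2 := by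
  have hl : ∀ {z}, z ∈ disk d → ContDiffAt ℝ 2 φ.invFactor z := fun hz =>
    (φ.contDiffAt_invFactor hz).of_le ENat.LEInfty.out
  have hf : ∀ {z}, z ∈ disk d → ContDiffAt ℝ 2 φ.toFun z := fun hz =>
    (φ.contDiffAt hz).of_le ENat.LEInfty.out
  have hq : ∀ {z}, z ∈ disk d → ContDiffAt ℝ ∞ (fun z => ‖φ.toFun z - φ.toFun y‖ ^ 2) z := fun hz =>
    ((φ.contDiffAt hz).sub contDiffAt_const).norm_sq ℝ
  -- The factor `1/Ω` is chosen so that the mixed terms cancel against `φ''`. Apart from a multiple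
  -- of `λ''`, which vanishes on orthogonal pairs, the Hessian of `w` is then proportional to the
  -- metric.
  set w : Space d → ℝ := fun z => φ.invFactor z • ‖φ.toFun z - φ.toFun y‖ ^ 2 with hw
  have hw2 : ∀ z ∈ disk d, ∀ u v : Space d, fderiv ℝ (fderiv ℝ w) z u v =
      ‖φ.toFun z - φ.toFun y‖ ^ 2 * fderiv ℝ (fderiv ℝ φ.invFactor) z u v +
        (2 * φ.factor z + 2 * inner ℝ (φ.toFun z - φ.toFun y) (fderiv ℝ φ.toFun z
          ((InnerProductSpace.toDual ℝ (Space d)).symm (fderiv ℝ φ.invFactor z)))) *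
            inner ℝ u v := by
    intro z hz u v
    have hΩ := φ.factor_pos z hz
    have h1 := congrArg (fun a => (inner ℝ (φ.toFun z - φ.toFun y) a : ℝ)) (φ.fderiv_fderiv_eq hz u v)
    simp only [inner_sub_right, real_inner_smul_right] at h1
    have hone : φ.invFactor z * φ.factor z = 1 := inv_mul_cancel₀ hΩ.ne'
    rw [hw, fderiv_fderiv_smul (hl hz) ((hq hz).of_le ENat.LEInfty.out),
      fderiv_fderiv_norm_sub_sq (hf hz), φ.conformal z hz,
      fderiv_norm_sub_sq_apply (φ.hasFDerivAt hz).differentiableAt,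
      fderiv_norm_sub_sq_apply (φ.hasFDerivAt hz).differentiableAt]
    simp only [smul_eq_mul]
    linear_combination 2 * h1 + 2 * φ.factor z * (inner ℝ u v : ℝ) * hone
  have hdim : ∀ u : Space d, ∃ t : Space d, ‖t‖ = 1 ∧ inner ℝ u t = (0 : ℝ) := by
    intro u
    obtain ⟨t, ht0, this, -⟩ := exists_ne_zero_orthogonal hd u u
    exact ⟨‖t‖⁻¹ • t, norm_smul_inv_norm ht0, by rw [real_inner_smul_right, this, mul_zero]⟩
  obtain ⟨e, he, -⟩ := hdim 0
  have hΩx := φ.factor_pos x hx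
  have key := eq_norm_sq_of_umbilic (disk d).isOpen (convex_ball 0 1) hdim (f := w)
    (fun z hz => (((φ.contDiffAt_invFactor hz).smul (hq hz)).of_le
      ENat.LEInfty.out).contDiffWithinAt)
    (fun z hz u v huv => by
      rw [hw2 z hz, huv, φ.fderiv_fderiv_invFactor_eq_zero hd hz huv]; ring) hy (by simp [hw])
    (by
      ext u
      rw [hw, fderiv_fun_smul ((hl hy).differentiableAt (by simp))
        ((hq hy).differentiableAt (by simp))]
      simp [fderiv_norm_sub_sq_apply (φ.hasFDerivAt hy).differentiableAt]) he x hx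
  -- At `y` the difference `φ z - φ y` vanishes and the Hessian of `w` is `2 Ω(y)` times the metric,
  -- which fixes the constant.
  rw [hw2 y hy, real_inner_self_eq_norm_sq, he] at key
  simp only [hw, invFactor, smul_eq_mul, sub_self, norm_zero, inner_zero_left] at key
  field_simp at key
  linarith

end ConformalEmbedding

/-! ### Change of variables in the two-point function. -/

namespace ConformalEmbedding

open Filter Topology

variable {d : ℕ} (φ : ConformalEmbedding d) {x : Space d}

/-- `φ × φ`. -/
def prodMap (p : Space d × Space d) : Space d × Space d := (φ.toFun p.1, φ.toFun p.2)

theorem injOn_prodMap : Set.InjOn φ.prodMap (diskSq d) := fun _ hp _ hq h =>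
  Prod.ext (φ.injOn hp.1 hq.1 (Prod.ext_iff.mp h).1) (φ.injOn hp.2 hq.2 (Prod.ext_iff.mp h).2)

theorem image_prodMap_subset : φ.prodMap '' diskSq d ⊆ diskSq d := by
  rintro _ ⟨p, hp, rfl⟩
  exact ⟨φ.mapsTo hp.1, φ.mapsTo hp.2⟩

theorem hasFDerivWithinAt_prodMap {p : Space d × Space d}
    (hp : p ∈ (diskSq d : Set (Space d × Space d))) :
    HasFDerivWithinAt φ.prodMap
      ((fderiv ℝ φ.toFun p.1).prodMap (fderiv ℝ φ.toFun p.2)) (diskSq d) p :=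
  ((φ.hasFDerivAt hp.1).prodMap p (φ.hasFDerivAt hp.2)).hasFDerivWithinAt

theorem abs_det_prodMap {p : Space d × Space d} (hp : p ∈ (diskSq d : Set (Space d × Space d))) :
    |((fderiv ℝ φ.toFun p.1).prodMap (fderiv ℝ φ.toFun p.2)).det| =
      (φ.factor p.1 * φ.factor p.2) ^ d := by
  rw [ContinuousLinearMap.det, ContinuousLinearMap.coe_prodMap, LinearMap.det_prodMap, mul_pow,
    ← φ.det_fderiv hp.1, ← φ.det_fderiv hp.2]
  exact abs_of_pos (mul_pos (φ.orientation _ hp.1) (φ.orientation _ hp.2))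

instance isAddHaarMeasure_volume_prod :
    (volume : Measure (Space d × Space d)).IsAddHaarMeasure :=
  inferInstanceAs ((volume : Measure (Space d)).prod (volume : Measure (Space d))).IsAddHaarMeasure

theorem integral_image_prodMap (g : Space d × Space d → ℝ) :
    ∫ p in φ.prodMap '' diskSq d, g p = ∫ p in (diskSq d : Set (Space d × Space d)),
      (φ.factor p.1 * φ.factor p.2) ^ d * g (φ.prodMap p) := by
  rw [integral_image_eq_integral_abs_det_fderiv_smul volume (diskSq d).isOpen.measurableSet
    (fun p hp => φ.hasFDerivWithinAt_prodMap hp) φ.injOn_prodMap]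
  refine setIntegral_congr_fun (diskSq d).isOpen.measurableSet fun p hp => ?_
  simp only [φ.abs_det_prodMap hp, smul_eq_mul]

theorem push_apply (f : Test d) (hx : x ∈ disk d) :
    φ.push f (φ.toFun x) = φ.factor x ^ (-(((d : ℝ) + 2) / 2)) * f x := by
  change φ.pushFun f (φ.toFun x) = _
  rw [pushFun, if_pos ⟨x, hx, rfl⟩, φ.inv_apply hx]

theorem push_eq_zero (f : Test d) (hx : x ∉ φ.toFun '' (disk d)) : φ.push f x = 0 :=
  if_neg hx

/-- Each variable carries `Ω^d` from the Jacobian and `Ω^(-(d+2)/2)` from `W_φ`, and `d - (d+2)/2 =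
(d-2)/2`. Off the image of `φ × φ` one of the two test functions is zero. -/
theorem kernelForm_push {P : Space d → Space d → ℝ} (hP : IsGreenKernel d P) (f g : Test d) :
    kernelForm hP (φ.push f) (φ.push g) =
      ∫ p in (diskSq d : Set (Space d × Space d)),
        ((φ.factor p.1 * φ.factor p.2) ^ (((d : ℝ) - 2) / 2) * P (φ.toFun p.1) (φ.toFun p.2)) *
          f p.1 * g p.2 := by
  simp only [kernelForm, LinearMap.mk₂_apply]
  rw [setIntegral_eq_of_subset_of_forall_sdiff_eq_zero (diskSq d).isOpen.measurableSet
    φ.image_prodMap_subset, φ.integral_image_prodMap]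
  · refine setIntegral_congr_fun (diskSq d).isOpen.measurableSet fun p hp => ?_
    have h1 := φ.factor_pos _ hp.1
    have h2 := φ.factor_pos _ hp.2
    have h3 : (φ.factor p.1 * φ.factor p.2) ^ (((d : ℝ) - 2) / 2) =
        (φ.factor p.1 * φ.factor p.2) ^ d * (φ.factor p.1 ^ (-(((d : ℝ) + 2) / 2)) *
          φ.factor p.2 ^ (-(((d : ℝ) + 2) / 2))) := by
      rw [← Real.mul_rpow h1.le h2.le, ← Real.rpow_natCast, ← Real.rpow_add (by positivity)]
      congr 1
      ring
    simp only [prodMap, φ.push_apply _ hp.1, φ.push_apply _ hp.2, h3]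
    ring
  · rintro p ⟨-, hp⟩
    by_cases h1 : p.1 ∈ φ.toFun '' (disk d)
    · by_cases h2 : p.2 ∈ φ.toFun '' (disk d)
      · obtain ⟨x, hx, hx'⟩ := h1
        obtain ⟨y, hy, hy'⟩ := h2
        exact absurd ⟨(x, y), ⟨hx, hy⟩, Prod.ext hx' hy'⟩ hp
      · rw [φ.push_eq_zero g h2, mul_zero]
    · rw [φ.push_eq_zero f h1, mul_zero, zero_mul]

/-- Conformal covariance of the Green function in dimension at least three. -/
theorem green_conformal (hd : 3 ≤ d) {y : Space d} (hx : x ∈ disk d) (hy : y ∈ disk d) :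
    (φ.factor x * φ.factor y) ^ (((d : ℝ) - 2) / 2) * green d (φ.toFun x) (φ.toFun y) =
      green d x y := by
  have h1 := φ.factor_pos _ hx
  have h2 := φ.factor_pos _ hy
  rw [green_eq_greenProfile (by omega), green_eq_greenProfile (by omega),
    φ.norm_sub_sq_eq hd hx hy, greenProfile, greenProfile, if_neg (by omega), if_neg (by omega),
    Real.mul_rpow (mul_pos h1 h2).le (sq_nonneg ‖x - y‖)]
  have h3 : (φ.factor x * φ.factor y) ^ (((d : ℝ) - 2) / 2) ≠ 0 := by positivity
  rw [mul_left_comm, mul_inv ((φ.factor x * φ.factor y) ^ _), mul_inv_cancel_left₀ h3]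

theorem kernelForm_green_push (hd : 3 ≤ d) (hG : IsGreenKernel d (green d)) (f g : Test d) :
    kernelForm hG (φ.push f) (φ.push g) = kernelForm hG f g := by
  rw [φ.kernelForm_push hG]
  refine setIntegral_congr_fun (diskSq d).isOpen.measurableSet fun p hp => ?_
  simp only [φ.green_conformal hd hp.1 hp.2]

/-! ### The plane: pulled-back Green kernels and the cocycle `H̃_φ`. -/

/-- `f ∘ φ⁻¹`, extended by zero. -/
noncomputable def transport (f : Test d) : Test d :=
  have hsub : Function.support ((φ.toFun '' disk d).indicator (f ∘ φ.inv)) ⊆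
      φ.toFun '' tsupport f := by
    intro x hx
    obtain ⟨y, hy, rfl⟩ := Set.mem_of_indicator_ne_zero hx
    rw [Function.mem_support, Set.indicator_of_mem (Set.mem_image_of_mem _ hy), Function.comp_apply,
      φ.inv_apply hy] at hx
    exact ⟨y, subset_tsupport f hx, rfl⟩
  { toFun := (φ.toFun '' disk d).indicator (f ∘ φ.inv)
    contDiff' := by
      rw [contDiff_iff_contDiffAt]
      intro x
      by_cases hx : x ∈ φ.toFun '' tsupport f
      · obtain ⟨y, hy, rfl⟩ := hx
        obtain ⟨hn, hi⟩ := φ.contDiffAt_inv (f.tsupport_subset hy)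
        refine (f.contDiff.contDiffAt.comp _ hi).congr_of_eventuallyEq ?_
        filter_upwards [hn] with z hz using Set.indicator_of_mem hz _
      · have : (φ.toFun '' disk d).indicator (f ∘ φ.inv) =ᶠ[𝓝 x] fun _ => 0 := by
          filter_upwards [(φ.isCompact_image f).isClosed.isOpen_compl.mem_nhds hx] with z hz
          by_contra h
          exact hz (hsub h)
        exact contDiffAt_const.congr_of_eventuallyEq this
    hasCompactSupport' := HasCompactSupport.of_support_subset_isCompact (φ.isCompact_image f) hsub
    tsupport_subset' := (closure_minimal hsub (φ.isCompact_image f).isClosed).trans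
      (Set.image_subset_iff.mpr fun _ hx => φ.mapsTo (f.tsupport_subset hx)) }

theorem transport_apply (f : Test d) (hx : x ∈ disk d) : φ.transport f (φ.toFun x) = f x := by
  change (φ.toFun '' disk d).indicator (f ∘ φ.inv) (φ.toFun x) = _
  rw [Set.indicator_of_mem (Set.mem_image_of_mem _ hx), Function.comp_apply, φ.inv_apply hx]

theorem tsupport_transport_subset (f : Test d) : tsupport (φ.transport f) ⊆ φ.toFun '' disk d := by
  refine (closure_minimal ?_ (φ.isCompact_image f).isClosed).trans
    (Set.image_mono f.tsupport_subset)
  intro x hx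
  obtain ⟨y, hy, rfl⟩ := Set.mem_of_indicator_ne_zero hx
  rw [Function.mem_support, φ.transport_apply f hy] at hx
  exact ⟨y, subset_tsupport f hx, rfl⟩

theorem laplace_transport (φ : ConformalEmbedding 2) (f : Test 2) {x : Space 2} (hx : x ∈ disk 2) :
    laplace 2 f x = φ.factor x ^ 2 * laplace 2 (φ.transport f) (φ.toFun x) := by
  have h : (f : Space 2 → ℝ) =ᶠ[𝓝 x] fun y => φ.transport f (φ.toFun y) := by
    filter_upwards [disk_mem_nhds hx] with y hy using (φ.transport_apply f hy).symm
  have h2 : lap f x = lap (fun y => φ.transport f (φ.toFun y)) x := by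
    simp only [lap, h.fderiv.fderiv_eq]
  rw [laplace_apply, laplace_apply, h2, φ.lap_comp hx
    ((φ.transport f).contDiff.contDiffAt.of_le ENat.LEInfty.out)]
  ring

theorem laplace_transport_eq_zero (f : Test d) (hx : x ∉ φ.toFun '' disk d) :
    laplace d (φ.transport f) x = 0 := by
  have h : (φ.transport f : Space d → ℝ) =ᶠ[𝓝 x] fun _ => 0 := by
    exact notMem_tsupport_iff_eventuallyEq.mp fun h => hx (φ.tsupport_transport_subset f h)
  have h2 : lap (φ.transport f) x = lap (fun _ => (0 : ℝ)) x := by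
    simp only [lap, h.fderiv.fderiv_eq]
  rw [laplace_apply, h2]
  simp [lap]

/-- In the plane `Δf` equals `Ω²` times `Δ(f ∘ φ⁻¹)` evaluated at `φ`, and `Ω²` is the Jacobian.
Substitution therefore yields the fundamental-solution identity for `f ∘ φ⁻¹` at the point `φ(y)`.
-/
theorem isGreenKernel_comp (φ : ConformalEmbedding 2) :
    IsGreenKernel 2 fun x y => green 2 (φ.toFun x) (φ.toFun y) := by
  have hG := isGreenKernel_green (d := 2) le_rfl
  refine isGreenKernel_of_forall_integral
    (fun x hx y hy => hG.symm _ (φ.mapsTo hx) _ (φ.mapsTo hy)) ?_ fun y hy f => ?_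
  · have h1 := (integrableOn_image_iff_integrableOn_abs_det_fderiv_smul volume
      (diskSq 2).isOpen.measurableSet (fun p hp => φ.hasFDerivWithinAt_prodMap hp)
      φ.injOn_prodMap fun p : Space 2 × Space 2 => green 2 p.1 p.2).mp
        ((integrableOn_green le_rfl).mono_set φ.image_prodMap_subset)
    -- The substitution rule controls only the kernel times the Jacobian. The inverse Jacobian may
    -- be unbounded near the boundary, so it is divided out on compact subsets.
    have h2 : ContinuousOn (fun p : Space 2 × Space 2 => ((φ.factor p.1 * φ.factor p.2) ^ 2)⁻¹)
        (diskSq 2) := by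
      refine ContinuousOn.inv₀ (((φ.contDiffOn_factor.continuousOn.comp continuousOn_fst
        fun p hp => hp.1).mul (φ.contDiffOn_factor.continuousOn.comp continuousOn_snd
        fun p hp => hp.2)).pow 2) fun p hp => ?_
      exact pow_ne_zero 2 (mul_pos (φ.factor_pos _ hp.1) (φ.factor_pos _ hp.2)).ne'
    rw [locallyIntegrableOn_iff (diskSq 2).isOpen.isLocallyClosed]
    intro K hKs hK
    refine ((h1.mono_set hKs).continuousOn_mul (h2.mono hKs) hK).congr_fun (fun p hp => ?_)
      hK.measurableSet
    have h3 := φ.factor_pos _ (hKs hp).1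
    have h4 := φ.factor_pos _ (hKs hp).2
    simp only [φ.abs_det_prodMap (hKs hp), prodMap, smul_eq_mul]
    field_simp
  · have hm : MeasurableSet (disk 2 : Set (Space 2)) := (disk 2).isOpen.measurableSet
    have h1 : ∀ x ∈ (disk 2 : Set (Space 2)), green 2 (φ.toFun x) (φ.toFun y) * laplace 2 f x =
        |(fderiv ℝ φ.toFun x).det| • (green 2 (φ.toFun x) (φ.toFun y) *
          laplace 2 (φ.transport f) (φ.toFun x)) := by
      intro x hx
      rw [φ.det_fderiv hx, abs_of_pos (pow_pos (φ.factor_pos x hx) 2), φ.laplace_transport f hx,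
        smul_eq_mul]
      ring
    rw [setIntegral_congr_fun hm h1, ← integral_image_eq_integral_abs_det_fderiv_smul volume hm
      (fun x hx => (φ.hasFDerivAt hx).hasFDerivWithinAt) φ.injOn
      (fun x => green 2 x (φ.toFun y) * laplace 2 (φ.transport f) x),
      ← setIntegral_eq_of_subset_of_forall_sdiff_eq_zero hm (Set.image_subset_iff.mpr φ.mapsTo),
      integral_green_mul_laplace le_rfl, φ.transport_apply f hy]
    rintro x ⟨-, hx⟩
    rw [φ.laplace_transport_eq_zero f hx, mul_zero]

theorem green_comp_eq (φ : ConformalEmbedding 2) (x y : Space 2) :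
    green 2 (φ.toFun x) (φ.toFun y) = green 2 x y - (2 * Real.pi)⁻¹ * φ.harmonicCocycle x y := by
  simp only [green, if_true, harmonicCocycle]
  ring

theorem isGreenKernel_sub_harmonicCocycle (φ : ConformalEmbedding 2) :
    IsGreenKernel 2 fun x y => green 2 x y - (2 * Real.pi)⁻¹ * φ.harmonicCocycle x y := by
  simpa only [green_comp_eq] using φ.isGreenKernel_comp

theorem kernelForm_sub_harmonicCocycle (φ : ConformalEmbedding 2) (hG : IsGreenKernel 2 (green 2))
    (hH : IsGreenKernel 2 fun x y => green 2 x y - (2 * Real.pi)⁻¹ * φ.harmonicCocycle x y)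
    (f g : Test 2) : kernelForm hH f g = kernelForm hG (φ.push f) (φ.push g) := by
  rw [φ.kernelForm_push hG]
  simp [kernelForm, green_comp_eq]

theorem ae_fst_ne_snd : ∀ᵐ p : Space 2 × Space 2, p.1 ≠ p.2 := by
  have hm : MeasurableSet {p : Space 2 × Space 2 | p.1 ≠ p.2} :=
    (measurableSet_eq_fun measurable_fst measurable_snd).compl
  rw [Measure.volume_eq_prod, Measure.ae_prod_iff_ae_ae hm]
  refine Eventually.of_forall fun x => ?_
  simp [ae_iff]

/-- The effect of `φ` on the two-point function if the cocycle `H̃_φ` is a coboundary. -/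
theorem kernelForm_push_of_harmonicCocycle_eq (φ : ConformalEmbedding 2)
    (hG : IsGreenKernel 2 (green 2)) {a : Space 2 → ℝ} (ha : ContinuousOn a (disk 2))
    (h : ∀ x ∈ disk 2, ∀ y ∈ disk 2, x ≠ y → φ.harmonicCocycle x y = -(a x + a y)) (f g : Test 2) :
    kernelForm hG (φ.push f) (φ.push g) = kernelForm hG f g + (2 * Real.pi)⁻¹ *
      ((∫ x in (disk 2 : Set (Space 2)), a x * f x) * (∫ y in (disk 2 : Set (Space 2)), g y) +
        (∫ x in (disk 2 : Set (Space 2)), f x) * ∫ y in (disk 2 : Set (Space 2)), a y * g y) := by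
  have hm : MeasurableSet (disk 2 : Set (Space 2)) := (disk 2).isOpen.measurableSet
  have haf : ∀ f : Test 2, Integrable fun x => a x * f x := fun f =>
    integrable_mul_testFunction (ha.locallyIntegrableOn hm) f
  have hf : ∀ f : Test 2, Integrable f := fun f =>
    f.continuous.integrable_of_hasCompactSupport f.hasCompactSupport
  have i1 : Integrable (fun p : Space 2 × Space 2 => a p.1 * f p.1 * g p.2)
      (volume.restrict (diskSq 2)) := ((haf f).mul_prod (hf g)).integrableOn
  have i2 : Integrable (fun p : Space 2 × Space 2 => f p.1 * (a p.2 * g p.2))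
      (volume.restrict (diskSq 2)) := ((hf f).mul_prod (haf g)).integrableOn
  have i3 : Integrable (fun p : Space 2 × Space 2 => (2 * Real.pi)⁻¹ *
      (a p.1 * f p.1 * g p.2 + f p.1 * (a p.2 * g p.2))) (volume.restrict (diskSq 2)) :=
    (i1.add i2).const_mul _
  rw [← setIntegral_prod_mul, ← setIntegral_prod_mul, ← Measure.volume_eq_prod]
  rw [φ.kernelForm_push hG]
  simp only [kernelForm, LinearMap.mk₂_apply]
  change _ = _ + _ * ((∫ p in (diskSq 2 : Set (Space 2 × Space 2)), a p.1 * f p.1 * g p.2) +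
    ∫ p in (diskSq 2 : Set (Space 2 × Space 2)), f p.1 * (a p.2 * g p.2))
  rw [← integral_add i1 i2, ← integral_const_mul, ← integral_add (integrable_kernel hG f g) i3]
  refine setIntegral_congr_ae (diskSq 2).isOpen.measurableSet ?_
  -- The coboundary formula is available only off the diagonal, since on it `H̃_φ` is `0` through
  -- the convention `log 0 = 0`; the diagonal is a null set.
  filter_upwards [ae_fst_ne_snd] with p hp hpD
  rw [φ.green_comp_eq, h _ hpD.1 _ hpD.2 hp]
  norm_num
  ring

/-! ### Failure of invariance under scaling. -/

/-- The contraction `x ↦ x / 2`. -/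
noncomputable def half (d : ℕ) : ConformalEmbedding d where
  toFun x := (2⁻¹ : ℝ) • x
  factor _ := 2⁻¹
  contDiffOn := (contDiff_const_smul _).contDiffOn
  mapsTo x hx := by
    have hx' : ‖x‖ < 1 := mem_ball_zero_iff.mp hx
    refine mem_ball_zero_iff.mpr ?_
    rw [norm_smul, norm_inv, Real.norm_ofNat]
    linarith [norm_nonneg x]
  injOn := (smul_right_injective _ (by norm_num : (2⁻¹ : ℝ) ≠ 0)).injOn
  contDiffOn_factor := contDiffOn_const
  factor_pos _ _ := by norm_num
  conformal x _ u v := by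
    have : fderiv ℝ (fun x : Space d => (2⁻¹ : ℝ) • x) x =
        (2⁻¹ : ℝ) • ContinuousLinearMap.id ℝ _ :=
      ((hasFDerivAt_id x).const_smul (2⁻¹ : ℝ)).fderiv
    rw [this]
    simp [real_inner_smul_left, real_inner_smul_right]
    ring
  orientation x _ := by
    have : fderiv ℝ (fun x : Space d => (2⁻¹ : ℝ) • x) x =
        (2⁻¹ : ℝ) • ContinuousLinearMap.id ℝ _ :=
      ((hasFDerivAt_id x).const_smul (2⁻¹ : ℝ)).fderiv
    rw [this, ContinuousLinearMap.det, ContinuousLinearMap.toLinearMap_smul, LinearMap.det_smul]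
    simp

/-- Scaling shifts the logarithm of the distance by `-log 2`, split into equal halves to display a
coboundary. -/
theorem half_harmonicCocycle {x y : Space 2} (h : x ≠ y) :
    (half 2).harmonicCocycle x y = -(Real.log 2 / 2 + Real.log 2 / 2) := by
  have h' : ‖x - y‖ ≠ 0 := norm_ne_zero_iff.mpr (sub_ne_zero.mpr h)
  simp only [harmonicCocycle, half]
  rw [← smul_sub, norm_smul, norm_inv, Real.norm_ofNat, Real.log_mul (by norm_num) h', Real.log_inv]
  ring

end ConformalEmbedding

theorem exists_test_integral_pos (d : ℕ) :
    ∃ f : Test d, 0 < ∫ x in (disk d : Set (Space d)), f x := by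
  let b : ContDiffBump (0 : Space d) := ⟨1 / 4, 1 / 2, by norm_num, by norm_num⟩
  let f : Test d :=
    { toFun := b
      contDiff' := b.contDiff
      hasCompactSupport' := b.hasCompactSupport
      tsupport_subset' := by
        rw [b.tsupport_eq]
        exact Metric.closedBall_subset_ball (by norm_num) }
  refine ⟨f, ?_⟩
  rw [setIntegral_eq_integral_of_forall_compl_eq_zero fun x hx => test_eq_zero_of_notMem f hx]
  exact b.integral_pos

theorem exists_state_ne (hG : IsGreenKernel 2 (green 2)) :
    ∃ (φ : ConformalEmbedding 2) (n : ℕ) (f : Fin n → Test 2),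
      state hG (observable f) ≠ state hG (observable fun i => φ.push (f i)) := by
  obtain ⟨f, hf⟩ := exists_test_integral_pos 2
  -- The two sides will differ by `(2π)⁻¹ log 2 (∫ f)²`, so a single `f` of nonzero integral, used
  -- twice, suffices.
  refine ⟨.half 2, 2, fun _ => f, ?_⟩
  rw [state_pair, state_pair, (ConformalEmbedding.half 2).kernelForm_push_of_harmonicCocycle_eq hG
    (a := fun _ => Real.log 2 / 2) continuousOn_const
    fun x _ y _ h => ConformalEmbedding.half_harmonicCocycle h, integral_const_mul]
  have h2 : 0 < Real.log 2 := Real.log_pos one_lt_two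
  have hpi := Real.pi_pos
  refine ne_of_lt ((lt_add_iff_pos_right _).mpr ?_)
  positivity

/-! ### Möbius transformations. -/

theorem toComplex_sub (x y : Space 2) : toComplex (x - y) = toComplex x - toComplex y := by
  apply Complex.ext <;> simp [toComplex]

theorem norm_toComplex (x : Space 2) : ‖toComplex x‖ = ‖x‖ := by
  rw [EuclideanSpace.norm_eq, Fin.sum_univ_two, Complex.norm_def, Complex.normSq_apply]
  simp [toComplex, sq]

theorem continuous_toComplex : Continuous toComplex := by
  refine (Isometry.of_dist_eq fun x y => ?_).continuous
  rw [dist_eq_norm, ← toComplex_sub, norm_toComplex, dist_eq_norm]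

/-- The cocycle of a Möbius transformation is a coboundary. -/
theorem ConformalEmbedding.harmonicCocycle_moebius (φ : ConformalEmbedding 2)
    {A : Matrix.SpecialLinearGroup (Fin 2) ℂ}
    (hA : ∀ x ∈ disk 2, A 1 0 * toComplex x + A 1 1 ≠ 0 ∧
      toComplex (φ.toFun x) = (A 0 0 * toComplex x + A 0 1) / (A 1 0 * toComplex x + A 1 1))
    {x y : Space 2} (hx : x ∈ disk 2) (hy : y ∈ disk 2) (hxy : x ≠ y) :
    φ.harmonicCocycle x y = -(Real.log ‖A 1 0 * toComplex x + A 1 1‖ +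
      Real.log ‖A 1 0 * toComplex y + A 1 1‖) := by
  obtain ⟨hx0, hx1⟩ := hA x hx
  obtain ⟨hy0, hy1⟩ := hA y hy
  have hdet : A 0 0 * A 1 1 - A 0 1 * A 1 0 = 1 := by
    rw [← Matrix.det_fin_two, A.det_coe]
  have h1 : toComplex (φ.toFun x) - toComplex (φ.toFun y) = (toComplex x - toComplex y) /
      ((A 1 0 * toComplex x + A 1 1) * (A 1 0 * toComplex y + A 1 1)) := by
    -- Over the common denominator the numerator is the determinant, which is `1`, times the
    -- difference of the two points.
    rw [hx1, hy1, div_sub_div _ _ hx0 hy0]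
    congr 1
    linear_combination (toComplex x - toComplex y) * hdet
  have h2 : ‖φ.toFun x - φ.toFun y‖ = ‖x - y‖ / (‖A 1 0 * toComplex x + A 1 1‖ *
      ‖A 1 0 * toComplex y + A 1 1‖) := by
    rw [← norm_toComplex, toComplex_sub, h1, norm_div, norm_mul, ← toComplex_sub, norm_toComplex]
  have h3 : ‖x - y‖ ≠ 0 := norm_ne_zero_iff.mpr (sub_ne_zero.mpr hxy)
  have h4 := norm_ne_zero_iff.mpr hx0
  have h5 := norm_ne_zero_iff.mpr hy0
  rw [harmonicCocycle, h2, Real.log_div h3 (mul_ne_zero h4 h5), Real.log_mul h4 h5]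
  ring

theorem state_push_moebius (hG : IsGreenKernel 2 (green 2)) (φ : ConformalEmbedding 2)
    (hφ : φ.IsMoebius) {n : ℕ} (f : Fin n → Test 2)
    (hf : ∀ i, ∫ x in (disk 2 : Set (Space 2)), f i x = 0) :
    state hG (observable f) = state hG (observable fun i => φ.push (f i)) := by
  obtain ⟨A, hA⟩ := hφ
  refine state_congr hG hG fun i j => ?_
  have ha : ContinuousOn (fun x => Real.log ‖A 1 0 * toComplex x + A 1 1‖) (disk 2) := by
    refine ContinuousOn.log (Continuous.continuousOn ?_) fun x hx =>
      norm_ne_zero_iff.mpr (hA x hx).1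
    exact ((continuous_const.mul continuous_toComplex).add continuous_const).norm
  -- Each correction term contains the plain integral of one of the two test functions as a factor,
  -- so both vanish.
  rw [φ.kernelForm_push_of_harmonicCocycle_eq hG ha
    fun x hx y hy h => φ.harmonicCocycle_moebius hA hx hy h, hf, hf]
  ring

end FreeField

open FreeField in
theorem mainTheorem10 :
    (∀ d : ℕ, 3 ≤ d → ∃ hG : IsGreenKernel d (green d),
      ∀ (φ : ConformalEmbedding d) (n : ℕ) (f : Fin n → Test d),
        state hG (observable f) = state hG (observable fun i => φ.push (f i))) ∧
    (∃ hG : IsGreenKernel 2 (green 2),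
      (∀ φ : ConformalEmbedding 2,
        ∃ hH : IsGreenKernel 2
            (fun x y => green 2 x y - (2 * Real.pi)⁻¹ * φ.harmonicCocycle x y),
          ∀ (n : ℕ) (f : Fin n → Test 2),
            state hH (observable f) = state hG (observable fun i => φ.push (f i))) ∧
      (∃ (φ : ConformalEmbedding 2) (n : ℕ) (f : Fin n → Test 2),
        state hG (observable f) ≠ state hG (observable fun i => φ.push (f i))) ∧
      (∀ φ : ConformalEmbedding 2, φ.IsMoebius →
        ∀ (n : ℕ) (f : Fin n → Test 2), (∀ i, ∫ x in (disk 2 : Set (Space 2)), f i x = 0) →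
          state hG (observable f) = state hG (observable fun i => φ.push (f i)))) := by
  have hG := isGreenKernel_green (d := 2) le_rfl
  refine ⟨fun d hd => ⟨isGreenKernel_green (by omega), fun φ n f => ?_⟩, hG, fun φ => ?_,
    exists_state_ne hG, fun φ hφ n f hf => state_push_moebius hG φ hφ f hf⟩
  · exact state_congr _ _ fun i j => (φ.kernelForm_green_push hd _ (f i) (f j)).symm
  · exact ⟨φ.isGreenKernel_sub_harmonicCocycle, fun n f =>
      state_congr _ _ fun i j => φ.kernelForm_sub_harmonicCocycle hG _ (f i) (f j)⟩
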